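/- **Theorem (Graphs of groups as categories).** *Conventions.* Categories are small and products are written in diagram order: $ab$ is defined when the codomain of $a$ is the domain of $b$. An *atom* is a non-invertible arrow $a$ such that $a=bc$ implies that $b$ or $c$ is invertible; $a\,\mathscr J\,b$ means $CaC=CbC$. A *Rees category* is a left and right cancellative category such that $aC\cap bC\neq\emptyset$ implies $aC\subseteq bC$ or $bC\subseteq aC$, and each principal right ideal is properly contained in only finitely many principal right ideals. It is *skeletal* if isomorphic objects are equal. A category is *connected* if any two objects are joined by a zig-zag of arrows. A *Serre category* is a skeletal Rees category that has finitely many objects and at least one, has finitely many $\mathscr J$-classes of atoms in each hom-set, and is connected. The *universal groupoid* of a category $C$ is the groupoid obtained by freely inverting all arrows of $C$. Isomorphism of categories is meant strictly (not equivalence). A *diagram of partial isomorphisms* $D$ is a directed graph with a group $G_e$ for each vertex $e$ and, for each edge $x\colon e\to f$, an isomorphism $\phi_x\colon (G_e)_x^+\to (G_f)_x^-$ between subgroups of $G_e$ and $G_f$. It is a *Serre diagram* if its directed graph is finite, nonempty and weakly connected. An isomorphism of diagrams consists of an isomorphism of directed graphs and isomorphisms of the vertex groups that carry the partial isomorphisms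 to one another; two diagrams are *conjugate* if the same holds after composing, for each edge $e\to f$, with an inner automorphism at each of its two ends. The category $\langle D\rangle$ is the quotient of the free category on the graph of $D$ with a loop added at each vertex $e$ for each $g\in G_e$, by the relations $g\cdot h=gh$ for $g,h\in G_e$ (the identity of $G_e$ being the identity arrow at $e$) and $g\cdot x=x\cdot\phi_x(g)$ for $g\in (G_e)^+_x$. If $C$ is a skeletal Rees category, an *atomic transversal* $T$ is a choice, in each hom-set, of exactly one representative of each $\mathscr J$-class of atoms. The diagram $D(C,T)$ has the objects of $C$ as vertices, the elements of $T$ as edges, the group of invertible elements of the monoid $eCe$ at each vertex $e$, and $\phi_x(g)=h$ whenever $gx=xh$ with $g$, $h$ in the vertex groups at the two ends of $x$. A *graph of groups* consists of a finite nonempty connected graph in the sense of Serre (edges $y$ with a fixed-point free reversal $y\mapsto\bar y$), vertex groups $G_P$, edge groups $G_y=G_{\bar y}$ and monomorphisms $G_y\to G_{t(y)}$, $c\mapsto c^y$, where $t(y)$ is the terminus of $y$. An *orientation* is a set of edges that contains exactly one of $y,\bar y$ for each edge $y$. Isomorphisms of oriented graphs of groups are isomorphisms of the graphs, preserving the orientation,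 together with isomorphisms of the vertex groups and the edge groups that commute with the monomorphisms. The diagram $D(\mathcal G)$ of an oriented graph of groups $\mathcal G$ has the same vertices and vertex groups, the positively oriented edges, and $\phi_y(c^{\bar y})=c^{y}$ for $c\in G_y$. The *fundamental groupoid* of $\mathcal G$ is the groupoid with object set the set of vertices that is generated by the elements of the vertex groups (as loops) and all the edges, subject to the relations of the vertex groups, $\bar y=y^{-1}$, and $c^{\bar y}\,y=y\,c^{y}$ for each edge $y$ and $c\in G_y$. *Statement.* 1. $\mathcal G\mapsto D(\mathcal G)$ is a correspondence between oriented graphs of groups and Serre diagrams of partial isomorphisms: $D(\mathcal G)$ is a Serre diagram; every Serre diagram is isomorphic to some $D(\mathcal G)$; and $\mathcal G\cong\mathcal G'$ if and only if $D(\mathcal G)\cong D(\mathcal G')$. 2. $D\mapsto\langle D\rangle$ is a correspondence between Serre diagrams of partial isomorphisms and Serre categories: if $D$ is a Serre diagram then $\langle D\rangle$ is a Serre category, and it has an atomic transversal $T$ with $D(\langle D\rangle,T)\cong D$; every Serre category $C$ has an atomic transversal, and for every atomic transversal $T$ of $C$ the diagram $D(C,T)$ is a Serre diagram and $\langle D(C,T)\rangle\cong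 C$; and for Serre diagrams $D,D'$, one has $\langle D\rangle\cong\langle D'\rangle$ if and only if $D$ and $D'$ are conjugate up to isomorphism of the underlying graphs and of the vertex groups. 3. The fundamental groupoid of an oriented graph of groups $\mathcal G$ is isomorphic to the universal groupoid of the Serre category $\langle D(\mathcal G)\rangle$. 4. The universal groupoid of a Serre category is connected. -/

import Mathlib

open CategoryTheory

universe u

/-!
# Categories

Products of arrows are written in diagram order: the product `ab` of the text is `a ≫ b`.
-/

section Categories

variable {C : Type u} [SmallCategory C]

/-- An atom: a non-invertible arrow such that in each factorization `a = bc` one of the two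
factors is invertible. -/
def IsAtomArrow {X Y : C} (a : X ⟶ Y) : Prop :=
  ¬ IsIso a ∧ ∀ (Z : C) (b : X ⟶ Z) (c : Z ⟶ Y), a = b ≫ c → IsIso b ∨ IsIso c

/-- The principal right ideal `aC`. All its elements have the same domain as `a`, so it is a set
of arrows starting at that domain. -/
def principalRightIdeal {X Y : C} (a : X ⟶ Y) : Set (Σ Z : C, X ⟶ Z) :=
  {p | ∃ c : Y ⟶ p.1, p.2 = a ≫ c}

/-- `a` belongs to the principal two-sided ideal `CbC`. -/
def MemPrincipalIdeal {X Y X' Y' : C} (a : X ⟶ Y) (b : X' ⟶ Y') : Prop :=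
  ∃ (p : X ⟶ X') (q : Y' ⟶ Y), a = p ≫ b ≫ q

/-- Green's relation `J`: `CaC = CbC`. -/
def GreenJ {X Y X' Y' : C} (a : X ⟶ Y) (b : X' ⟶ Y') : Prop :=
  MemPrincipalIdeal a b ∧ MemPrincipalIdeal b a

theorem MemPrincipalIdeal.trans {X Y X' Y' X'' Y'' : C} {a : X ⟶ Y} {b : X' ⟶ Y'}
    {c : X'' ⟶ Y''} (h : MemPrincipalIdeal a b) (k : MemPrincipalIdeal b c) :
    MemPrincipalIdeal a c := by
  obtain ⟨p, q, rfl⟩ := h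
  obtain ⟨r, s, rfl⟩ := k
  exact ⟨p ≫ r, s ≫ q, by simp⟩

/-- The relation `J` on the atoms of one hom-set. -/
def atomSetoid (X Y : C) : Setoid {a : X ⟶ Y // IsAtomArrow a} where
  r a b := GreenJ a.1 b.1
  iseqv :=
    { refl := fun a => ⟨⟨𝟙 _, 𝟙 _, by simp⟩, ⟨𝟙 _, 𝟙 _, by simp⟩⟩
      symm := fun h => ⟨h.2, h.1⟩
      trans := fun h k => ⟨h.1.trans k.1, k.2.trans h.2⟩ }

variable (C)

def LeftCancellative : Prop :=
  ∀ (X Y Z : C) (a : X ⟶ Y) (x y : Y ⟶ Z), a ≫ x = a ≫ y → x = y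

def RightCancellative : Prop :=
  ∀ (X Y Z : C) (x y : X ⟶ Y) (a : Y ⟶ Z), x ≫ a = y ≫ a → x = y

/-- Principal right ideals that meet are comparable. (Ideals `aC` and `bC` can only meet if
`a` and `b` have the same domain.) -/
def RightRigid : Prop :=
  ∀ (X Y Z : C) (a : X ⟶ Y) (b : X ⟶ Z),
    (principalRightIdeal a ∩ principalRightIdeal b).Nonempty →
      principalRightIdeal a ⊆ principalRightIdeal b ∨
        principalRightIdeal b ⊆ principalRightIdeal a

/-- A left Rees category: left cancellative, right rigid, and each principal right ideal is
properly contained in only finitely many principal right ideals. -/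
structure IsLeftReesCategory : Prop where
  leftCancellative : LeftCancellative C
  rightRigid : RightRigid C
  finite_above : ∀ (X Y : C) (a : X ⟶ Y),
    {I : Set (Σ Z : C, X ⟶ Z) |
      (∃ (Z : C) (b : X ⟶ Z), I = principalRightIdeal b) ∧ principalRightIdeal a ⊂ I}.Finite

/-- A Rees category: a left Rees category that is also right cancellative. -/
structure IsReesCategory : Prop extends IsLeftReesCategory C where
  rightCancellative : RightCancellative C

/-- Any two objects are joined by a zig-zag of arrows. -/
def ZigzagConnected (C : Type u) [SmallCategory C] : Prop :=
  ∀ e f : C, Zigzag e f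

/-- A Serre category: a skeletal Rees category with finitely many objects and at least one,
with finitely many `J`-classes of atoms in each hom-set, and connected. -/
structure IsSerreCategory : Prop extends IsReesCategory C where
  skeletal : Skeletal C
  finite_obj : Finite C
  nonempty_obj : Nonempty C
  finite_atoms : ∀ X Y : C, Finite (Quotient (atomSetoid X Y))
  connected : ZigzagConnected C

/-- Isomorphism of categories: a functor that is bijective on objects and on each hom-set. -/
def CatIsomorphic (C D : Type u) [SmallCategory C] [SmallCategory D] : Prop :=
  ∃ F : C ⥤ D, Function.Bijective F.obj ∧
    ∀ X Y : C, Function.Bijective (fun a : X ⟶ Y => F.map a)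

end Categories

/-!
# Diagrams of partial isomorphisms
-/

/-- A diagram of partial isomorphisms: a directed graph with a group `grp e` at each vertex `e`
and, for each edge `x` from `e` to `f`, an isomorphism from a subgroup of `grp e` to a subgroup
of `grp f`. -/
structure PartialIsoDiagram where
  V : Type u
  Edge : V → V → Type u
  grp : V → Type u
  [group : ∀ e, Group (grp e)]
  dom : ∀ {e f : V}, Edge e f → Subgroup (grp e)
  cod : ∀ {e f : V}, Edge e f → Subgroup (grp f)
  φ : ∀ {e f : V} (x : Edge e f), dom x ≃* cod x

attribute [instance] PartialIsoDiagram.group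

namespace PartialIsoDiagram

/-- The graph of the partial isomorphism at `x`: `φ_x` is defined at `g` and `φ_x(g) = h`. -/
def Maps (D : PartialIsoDiagram.{u}) {e f : D.V} (x : D.Edge e f) (g : D.grp e) (h : D.grp f) :
    Prop :=
  ∃ hg : g ∈ D.dom x, (D.φ x ⟨g, hg⟩ : D.grp f) = h

/-- A Serre diagram: the underlying directed graph is finite, nonempty and weakly connected. -/
structure IsSerre (D : PartialIsoDiagram.{u}) : Prop where
  finite_vertices : Finite D.V
  finite_edges : ∀ e f : D.V, Finite (D.Edge e f)
  nonempty_vertices : Nonempty D.V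
  connected : ∀ e f : D.V, Relation.EqvGen (fun a b => Nonempty (D.Edge a b)) e f

/-- Isomorphism of diagrams: an isomorphism of directed graphs and isomorphisms of the vertex
groups that carry the partial isomorphisms of `D` to those of `D'`. -/
structure Iso (D D' : PartialIsoDiagram.{u}) where
  vert : D.V ≃ D'.V
  edge : ∀ {e f : D.V}, D.Edge e f ≃ D'.Edge (vert e) (vert f)
  grp : ∀ e : D.V, D.grp e ≃* D'.grp (vert e)
  maps_iff : ∀ {e f : D.V} (x : D.Edge e f) (g : D.grp e) (h : D.grp f),
    D.Maps x g h ↔ D'.Maps (edge x) (grp e g) (grp f h)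

/-- Conjugacy of diagrams, up to an isomorphism of the underlying graphs and of the vertex
groups: for each edge `x`, the partial isomorphism at `x` is carried to the one at the
corresponding edge by inner automorphisms `α` and `β` of the two vertex groups (so `α` and `β`
match the domains and the codomains, and `β φ_x = φ_y α`). -/
structure ConjIso (D D' : PartialIsoDiagram.{u}) where
  vert : D.V ≃ D'.V
  edge : ∀ {e f : D.V}, D.Edge e f ≃ D'.Edge (vert e) (vert f)
  grp : ∀ e : D.V, D.grp e ≃* D'.grp (vert e)
  conj : ∀ {e f : D.V} (x : D.Edge e f), ∃ (a : D'.grp (vert e)) (b : D'.grp (vert f)),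
    ∀ (g : D.grp e) (h : D.grp f),
      D.Maps x g h ↔ D'.Maps (edge x) (MulAut.conj a (grp e g)) (MulAut.conj b (grp f h))

/-- The edges of the directed graph obtained from the one of `D` by adjoining at each vertex `e`
a loop for each element of `grp e`. -/
inductive Gen (D : PartialIsoDiagram.{u}) : D.V → D.V → Type u
  | loop {e : D.V} (g : D.grp e) : Gen D e e
  | edge {e f : D.V} (x : D.Edge e f) : Gen D e f

/-- The vertices of `D`, as the vertices of the graph with edges `Gen D`. -/
def GenVert (D : PartialIsoDiagram.{u}) : Type u := D.V

instance (D : PartialIsoDiagram.{u}) : Quiver D.GenVert := ⟨fun e f => Gen D e f⟩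

/-- The loop of `g`, as an arrow of the free category. -/
def freeLoop (D : PartialIsoDiagram.{u}) {e : D.V} (g : D.grp e) :
    (Paths.of D.GenVert).obj e ⟶ (Paths.of D.GenVert).obj e :=
  (Paths.of D.GenVert).map (X := e) (Y := e) (Gen.loop g)

/-- The edge `x`, as an arrow of the free category. -/
def freeEdge (D : PartialIsoDiagram.{u}) {e f : D.V} (x : D.Edge e f) :
    (Paths.of D.GenVert).obj e ⟶ (Paths.of D.GenVert).obj f :=
  (Paths.of D.GenVert).map (X := e) (Y := f) (Gen.edge x)

/-- The defining relations of `⟨D⟩`: the group operation (with its identity) at each vertex, and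
`g · x = x · φ_x(g)` for `g` in the domain of `φ_x`. -/
inductive PresRel (D : PartialIsoDiagram.{u}) : HomRel (Paths D.GenVert)
  | one (e : D.V) : PresRel D (D.freeLoop (1 : D.grp e)) (𝟙 _)
  | mul {e : D.V} (g h : D.grp e) :
      PresRel D (D.freeLoop g ≫ D.freeLoop h) (D.freeLoop (g * h))
  | comm {e f : D.V} (x : D.Edge e f) (g : D.dom x) :
      PresRel D (D.freeLoop (g : D.grp e) ≫ D.freeEdge x)
        (D.freeEdge x ≫ D.freeLoop (D.φ x g : D.grp f))

/-- The category `⟨D⟩` presented by `D`. -/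
abbrev PresCat (D : PartialIsoDiagram.{u}) : Type u := CategoryTheory.Quotient D.PresRel

end PartialIsoDiagram

/-!
# The diagram of a Rees category relative to an atomic transversal
-/

section DiagramOfCategory

variable {C : Type u} [SmallCategory C]

/-- The local group at `e`: the invertible arrows from `e` to `e`, multiplied in diagram order. -/
def LocalGroup (e : C) : Type u := e ≅ e

instance (e : C) : Group (LocalGroup e) where
  mul a b := Iso.trans a b
  one := Iso.refl e
  inv a := Iso.symm a
  mul_assoc a b c := Iso.trans_assoc a b c
  one_mul a := Iso.refl_trans a
  mul_one a := Iso.trans_refl a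
  inv_mul_cancel a := Iso.symm_self_id a

/-- An element of the local group as an arrow. -/
def LocalGroup.arrow {e : C} (g : LocalGroup e) : e ⟶ e := Iso.hom g

theorem LocalGroup.arrow_injective {e : C} {g h : LocalGroup e} (w : g.arrow = h.arrow) :
    g = h := Iso.ext w

theorem LocalGroup.arrow_mul {e : C} (g h : LocalGroup e) :
    (g * h).arrow = g.arrow ≫ h.arrow := rfl

theorem LocalGroup.arrow_one (e : C) : (1 : LocalGroup e).arrow = 𝟙 e := rfl

theorem LocalGroup.inv_arrow {e : C} (g : LocalGroup e) : g⁻¹.arrow ≫ g.arrow = 𝟙 e :=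
  Iso.inv_hom_id g

theorem LocalGroup.arrow_inv {e : C} (g : LocalGroup e) : g.arrow ≫ g⁻¹.arrow = 𝟙 e :=
  Iso.hom_inv_id g

theorem LocalGroup.inv_comm {e f : C} {x : e ⟶ f} {g : LocalGroup e} {h : LocalGroup f}
    (w : g.arrow ≫ x = x ≫ h.arrow) : g⁻¹.arrow ≫ x = x ≫ h⁻¹.arrow := by
  have : g⁻¹.arrow ≫ (g.arrow ≫ x) ≫ h⁻¹.arrow = g⁻¹.arrow ≫ (x ≫ h.arrow) ≫ h⁻¹.arrow := by
    rw [w]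
  rw [Category.assoc, Category.assoc, h.arrow_inv, Category.comp_id, ← Category.assoc,
    g.inv_arrow, Category.id_comp] at this
  exact this.symm

variable (C) in
/-- An atomic transversal: for each hom-set, a set of atoms that contains exactly one member of
each `J`-class of atoms of that hom-set. -/
structure AtomicTransversal where
  carrier : ∀ e f : C, Set (e ⟶ f)
  isAtom : ∀ (e f : C), ∀ x ∈ carrier e f, IsAtomArrow x
  existsUnique : ∀ (e f : C) (a : e ⟶ f), IsAtomArrow a → ∃! x, x ∈ carrier e f ∧ GreenJ a x

/-- The elements `g` of the local group at `e` with `gx = xh` for some `h` in the local group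
at `f`. -/
def atomDom {e f : C} (x : e ⟶ f) : Subgroup (LocalGroup e) where
  carrier := {g | ∃ h : LocalGroup f, g.arrow ≫ x = x ≫ h.arrow}
  one_mem' := ⟨1, by simp [LocalGroup.arrow_one]⟩
  mul_mem' := by
    rintro a b ⟨h, hh⟩ ⟨k, hk⟩
    exact ⟨h * k, by
      rw [LocalGroup.arrow_mul, LocalGroup.arrow_mul, Category.assoc, hk, ← Category.assoc, hh,
        Category.assoc]⟩
  inv_mem' := by
    rintro a ⟨h, hh⟩
    exact ⟨h⁻¹, LocalGroup.inv_comm hh⟩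

/-- The elements `h` of the local group at `f` with `gx = xh` for some `g` in the local group
at `e`. -/
def atomCod {e f : C} (x : e ⟶ f) : Subgroup (LocalGroup f) where
  carrier := {h | ∃ g : LocalGroup e, g.arrow ≫ x = x ≫ h.arrow}
  one_mem' := ⟨1, by simp [LocalGroup.arrow_one]⟩
  mul_mem' := by
    rintro a b ⟨h, hh⟩ ⟨k, hk⟩
    exact ⟨h * k, by
      rw [LocalGroup.arrow_mul, LocalGroup.arrow_mul, Category.assoc, hk, ← Category.assoc, hh,
        Category.assoc]⟩
  inv_mem' := by
    rintro a ⟨h, hh⟩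
    exact ⟨h⁻¹, LocalGroup.inv_comm hh⟩

/-- The map `g ↦ h` where `gx = xh`, on the domain where such an `h` exists. -/
noncomputable def atomFun {e f : C} (x : e ⟶ f) (g : atomDom x) : atomCod x :=
  ⟨Classical.choose g.2, g.1, Classical.choose_spec g.2⟩

theorem atomFun_spec {e f : C} (x : e ⟶ f) (g : atomDom x) :
    g.1.arrow ≫ x = x ≫ (atomFun x g).1.arrow :=
  Classical.choose_spec g.2

/-- In a Rees category, `g ↦ h` where `gx = xh` is an isomorphism from `atomDom x` to
`atomCod x`. -/
noncomputable def atomIso (hC : IsReesCategory C) {e f : C} (x : e ⟶ f) :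
    atomDom x ≃* atomCod x :=
  MulEquiv.ofBijective
    (MonoidHom.mk' (atomFun x) (fun a b => by
      apply Subtype.ext
      apply LocalGroup.arrow_injective
      apply hC.leftCancellative _ _ _ x
      rw [← atomFun_spec, Subgroup.coe_mul, Subgroup.coe_mul, LocalGroup.arrow_mul,
        LocalGroup.arrow_mul, Category.assoc, atomFun_spec x b, ← Category.assoc,
        atomFun_spec x a, Category.assoc]))
    ⟨fun a b (h : atomFun x a = atomFun x b) => by
      apply Subtype.ext
      apply LocalGroup.arrow_injective
      apply hC.rightCancellative _ _ _ _ _ x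
      rw [atomFun_spec, atomFun_spec, h],
    fun h => by
      obtain ⟨h, g, hg⟩ := h
      refine ⟨⟨g, h, hg⟩, ?_⟩
      apply Subtype.ext
      apply LocalGroup.arrow_injective
      apply hC.leftCancellative _ _ _ x
      exact (atomFun_spec x ⟨g, h, hg⟩).symm.trans hg⟩

/-- The diagram of partial isomorphisms of a Rees category relative to an atomic transversal. -/
noncomputable def AtomicTransversal.diagram (T : AtomicTransversal C) (hC : IsReesCategory C) :
    PartialIsoDiagram.{u} where
  V := C
  Edge e f := T.carrier e f
  grp e := LocalGroup e
  dom x := atomDom x.1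
  cod x := atomCod x.1
  φ x := atomIso hC x.1

end DiagramOfCategory

/-!
# Graphs of groups
-/

/-- A graph in the sense of Serre: `E P Q` is the set of edges with origin `P` and terminus `Q`,
and `bar` is the fixed-point free involution that reverses edges. -/
structure SerreGraph where
  V : Type u
  E : V → V → Type u
  bar : ∀ {P Q : V}, E P Q → E Q P
  bar_bar : ∀ {P Q : V} (y : E P Q), bar (bar y) = y
  bar_ne : ∀ {P : V} (y : E P P), bar y ≠ y

namespace SerreGraph

/-- Geometric edges: edges up to reversal. -/
def GeomEdge (Y : SerreGraph.{u}) : Type u :=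
  Quot (fun (y z : Σ P Q : Y.V, Y.E P Q) => z = ⟨y.2.1, y.1, Y.bar y.2.2⟩)

/-- The geometric edge of an edge. -/
def geom (Y : SerreGraph.{u}) {P Q : Y.V} (y : Y.E P Q) : Y.GeomEdge := Quot.mk _ ⟨P, Q, y⟩

theorem geom_bar (Y : SerreGraph.{u}) {P Q : Y.V} (y : Y.E P Q) :
    Y.geom y = Y.geom (Y.bar y) :=
  Quot.sound rfl

end SerreGraph

/-- A graph of groups: a finite, nonempty, connected graph, a group for each vertex, a group for
each edge with the same group for an edge and its reverse (so the edge groups are indexed by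
geometric edges), and for each edge `y` a monomorphism from the group of `y` to the group of the
terminus of `y`. -/
structure GraphOfGroups extends SerreGraph.{u} where
  finite_vertices : Finite V
  finite_edges : ∀ P Q : V, Finite (E P Q)
  nonempty_vertices : Nonempty V
  connected : ∀ P Q : V, Relation.ReflTransGen (fun a b => Nonempty (E a b)) P Q
  vgrp : V → Type u
  [vgroup : ∀ P, Group (vgrp P)]
  egrp : toSerreGraph.GeomEdge → Type u
  [egroup : ∀ q, Group (egrp q)]
  ι : ∀ {P Q : V} (y : E P Q), egrp (toSerreGraph.geom y) →* vgrp Q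
  ι_injective : ∀ {P Q : V} (y : E P Q), Function.Injective (ι y)

attribute [instance] GraphOfGroups.vgroup GraphOfGroups.egroup

namespace GraphOfGroups

/-- The identification of edge groups along an equality of geometric edges. -/
def ecast (G : GraphOfGroups.{u}) {q r : G.GeomEdge} (h : q = r) : G.egrp q ≃* G.egrp r :=
  h ▸ MulEquiv.refl (G.egrp q)

/-- The monomorphism from the group of `y` to the group of the origin of `y`: the one that
belongs to the reverse of `y`. -/
def ιo (G : GraphOfGroups.{u}) {P Q : G.V} (y : G.E P Q) : G.egrp (G.geom y) →* G.vgrp P :=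
  (G.ι (G.bar y)).comp (G.ecast (G.geom_bar y)).toMonoidHom

theorem ιo_injective (G : GraphOfGroups.{u}) {P Q : G.V} (y : G.E P Q) :
    Function.Injective (G.ιo y) :=
  (G.ι_injective (G.bar y)).comp (G.ecast (G.geom_bar y)).injective

/-- Generators of the fundamental groupoid: the elements of the vertex groups, as loops, and all
edges. -/
inductive Gen (G : GraphOfGroups.{u}) : G.V → G.V → Type u
  | loop {P : G.V} (g : G.vgrp P) : Gen G P P
  | edge {P Q : G.V} (y : G.E P Q) : Gen G P Q

/-- The vertices of the graph, as the vertices of the directed graph with edges `Gen G`. -/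
def GenVert (G : GraphOfGroups.{u}) : Type u := G.V

instance (G : GraphOfGroups.{u}) : Quiver G.GenVert := ⟨fun P Q => Gen G P Q⟩

/-- The loop of `g`, as an arrow of the free groupoid. -/
def freeLoop (G : GraphOfGroups.{u}) {P : G.V} (g : G.vgrp P) :
    (Quiver.FreeGroupoid.of G.GenVert).obj P ⟶ (Quiver.FreeGroupoid.of G.GenVert).obj P :=
  (Quiver.FreeGroupoid.of G.GenVert).map (X := P) (Y := P) (Gen.loop g)

/-- The edge `y`, as an arrow of the free groupoid. -/
def freeEdge (G : GraphOfGroups.{u}) {P Q : G.V} (y : G.E P Q) :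
    (Quiver.FreeGroupoid.of G.GenVert).obj P ⟶ (Quiver.FreeGroupoid.of G.GenVert).obj Q :=
  (Quiver.FreeGroupoid.of G.GenVert).map (X := P) (Y := Q) (Gen.edge y)

/-- The defining relations of the fundamental groupoid: the group operation at each vertex, the
reverse of `y` is the inverse of `y`, and `ιo(c) · y = y · ι(c)` for `c` in the group of `y`. -/
inductive FundRel (G : GraphOfGroups.{u}) : HomRel (Quiver.FreeGroupoid G.GenVert)
  | one (P : G.V) : FundRel G (G.freeLoop (1 : G.vgrp P)) (𝟙 _)
  | mul {P : G.V} (g h : G.vgrp P) :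
      FundRel G (G.freeLoop g ≫ G.freeLoop h) (G.freeLoop (g * h))
  | bar {P Q : G.V} (y : G.E P Q) :
      FundRel G (G.freeEdge (G.bar y)) (Groupoid.inv (G.freeEdge y))
  | comm {P Q : G.V} (y : G.E P Q) (c : G.egrp (G.geom y)) :
      FundRel G (G.freeLoop (G.ιo y c) ≫ G.freeEdge y) (G.freeEdge y ≫ G.freeLoop (G.ι y c))

/-- The fundamental groupoid of a graph of groups. -/
abbrev FundGroupoid (G : GraphOfGroups.{u}) : Type u := CategoryTheory.Quotient G.FundRel

end GraphOfGroups

/-- A graph of groups with an orientation: a set of edges that contains exactly one edge of each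
pair of mutually reverse edges. -/
structure OrientedGraphOfGroups extends GraphOfGroups.{u} where
  pos : ∀ {P Q : V}, E P Q → Prop
  pos_bar : ∀ {P Q : V} (y : E P Q), pos (bar y) ↔ ¬ pos y

namespace OrientedGraphOfGroups

/-- Isomorphism of oriented graphs of groups: an isomorphism of graphs that preserves the
orientation, together with isomorphisms of the vertex groups and of the edge groups that commute
with the monomorphisms at both ends of each edge. -/
structure Iso (G G' : OrientedGraphOfGroups.{u}) where
  vert : G.V ≃ G'.V
  edge : ∀ {P Q : G.V}, G.E P Q ≃ G'.E (vert P) (vert Q)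
  edge_bar : ∀ {P Q : G.V} (y : G.E P Q), edge (G.bar y) = G'.bar (edge y)
  edge_pos : ∀ {P Q : G.V} (y : G.E P Q), G'.pos (edge y) ↔ G.pos y
  vgrp : ∀ P : G.V, G.vgrp P ≃* G'.vgrp (vert P)
  egrp : ∀ {P Q : G.V} (y : G.E P Q), G.egrp (G.geom y) ≃* G'.egrp (G'.geom (edge y))
  map_ι : ∀ {P Q : G.V} (y : G.E P Q) (c : G.egrp (G.geom y)),
    vgrp Q (G.ι y c) = G'.ι (edge y) (egrp y c)
  map_ιo : ∀ {P Q : G.V} (y : G.E P Q) (c : G.egrp (G.geom y)),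
    vgrp P (G.ιo y c) = G'.ιo (edge y) (egrp y c)

/-- The diagram of partial isomorphisms of an oriented graph of groups: its edges are the
positive edges, and the partial isomorphism at `y` sends `ιo(c)` to `ι(c)` for each `c` in the
group of `y`. -/
noncomputable def diagram (G : OrientedGraphOfGroups.{u}) : PartialIsoDiagram.{u} where
  V := G.V
  Edge P Q := {y : G.E P Q // G.pos y}
  grp := G.vgrp
  dom y := (G.ιo y.1).range
  cod y := (G.ι y.1).range
  φ y := (MonoidHom.ofInjective (G.ιo_injective y.1)).symm.trans
    (MonoidHom.ofInjective (G.ι_injective y.1))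

end OrientedGraphOfGroups

/-! The core is a normal form theorem for `⟨D⟩`, as for HNN extensions but with uninverted edges. By
g·x = x·φ_x(g), an element of a vertex group can be pushed to the right through x, up to a
representative of a coset of the domain of φ_x. So each arrow is t₁x₁t₂x₂⋯tₙxₙg with chosen coset
representatives tᵢ. For uniqueness, such words are made into a category `NFCat` in which the
relations of `⟨D⟩` hold; the resulting functor `toNF` recovers the word.

Edges never cancel, so the number of edges is an additive length: invertible arrows have length 0
and atoms have length 1. Since the first edge and the first coset of an arrow are determined, `⟨D⟩`
is left cancellative and rigid; injectivity of φ_x gives right cancellation. Local groups, J-classes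
of atoms and relations gx = xh in `⟨D⟩` are exactly those given by D.

Conversely, in a Rees category the finiteness condition on ideals factors each arrow into invertible
arrows and atoms (`arrow_induction`), and rigidity makes the first atom unique up to an invertible
factor (`exists_isIso_of_atom_comp_eq`). `Realization.IsTransversal` isolates what a functor from
`⟨D⟩` to a skeletal Rees category needs in order to be an isomorphism. It is applied to the
tautological functor from `⟨D(C,T)⟩` to C, and to the functor of a conjugacy, which sends x to
a⁻¹x'b. In the other direction, an isomorphism of categories preserves J, hence sends x to some ax'b
with a, b in vertex groups, which is a conjugacy.

For graphs of groups, an edge group with its two monomorphisms is the same as the graph of a partial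
isomorphism, and the orientation selects its direction. The fundamental and the universal groupoid
have the same generators and relations once the negative edges are read as inverses of positive
ones. -/

namespace PartialIsoDiagram

/-! ### Arrows and functors of the presented category -/

section Presentation

variable (D : PartialIsoDiagram.{u})

/-- The object of `⟨D⟩` at a vertex. -/
def obj (e : D.V) : D.PresCat := ⟨e⟩

/-- The element `g` of a vertex group, as an arrow of `⟨D⟩`. -/
def loop {e : D.V} (g : D.grp e) : D.obj e ⟶ D.obj e :=
  (Quotient.functor D.PresRel).map (D.freeLoop g)

/-- The edge `x`, as an arrow of `⟨D⟩`. -/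
def edge {e f : D.V} (x : D.Edge e f) : D.obj e ⟶ D.obj f :=
  (Quotient.functor D.PresRel).map (D.freeEdge x)

theorem loop_one (e : D.V) : D.loop (1 : D.grp e) = 𝟙 (D.obj e) :=
  CategoryTheory.Quotient.sound _ (PresRel.one e)

theorem loop_mul {e : D.V} (g h : D.grp e) : D.loop (g * h) = D.loop g ≫ D.loop h :=
  (CategoryTheory.Quotient.sound _ (PresRel.mul g h)).symm

theorem loop_comm {e f : D.V} (x : D.Edge e f) (g : D.dom x) :
    D.loop (g : D.grp e) ≫ D.edge x = D.edge x ≫ D.loop (D.φ x g : D.grp f) :=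
  CategoryTheory.Quotient.sound _ (PresRel.comm x g)

theorem loop_mul_assoc {e : D.V} (g h : D.grp e) {X : D.PresCat} (a : D.obj e ⟶ X) :
    D.loop (g * h) ≫ a = D.loop g ≫ D.loop h ≫ a := by
  rw [loop_mul, Category.assoc]

theorem loop_comm_assoc {e f : D.V} (x : D.Edge e f) (g : D.dom x) {X : D.PresCat}
    (a : D.obj f ⟶ X) :
    D.loop (g : D.grp e) ≫ D.edge x ≫ a = D.edge x ≫ D.loop (D.φ x g : D.grp f) ≫ a := by
  rw [← Category.assoc, loop_comm, Category.assoc]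

theorem loop_inv_mul {e : D.V} (g : D.grp e) : D.loop g⁻¹ ≫ D.loop g = 𝟙 _ := by
  rw [← loop_mul, inv_mul_cancel, loop_one]

theorem loop_mul_inv {e : D.V} (g : D.grp e) : D.loop g ≫ D.loop g⁻¹ = 𝟙 _ := by
  rw [← loop_mul, mul_inv_cancel, loop_one]

theorem loop_inv_mul_assoc {e : D.V} (g : D.grp e) {X : D.PresCat} (a : D.obj e ⟶ X) :
    D.loop g⁻¹ ≫ D.loop g ≫ a = a := by
  rw [← loop_mul_assoc, inv_mul_cancel, loop_one, Category.id_comp]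

theorem loop_mul_inv_assoc {e : D.V} (g : D.grp e) {X : D.PresCat} (a : D.obj e ⟶ X) :
    D.loop g ≫ D.loop g⁻¹ ≫ a = a := by
  rw [← loop_mul_assoc, mul_inv_cancel, loop_one, Category.id_comp]

/-- The loop of `g` as an automorphism. -/
def loopIso {e : D.V} (g : D.grp e) : D.obj e ≅ D.obj e :=
  ⟨D.loop g, D.loop g⁻¹, D.loop_mul_inv g, D.loop_inv_mul g⟩

instance {e : D.V} (g : D.grp e) : IsIso (D.loop g) := (D.loopIso g).isIso_hom

variable {D}

/-- The functor on `⟨D⟩` with given values on the generators. -/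
def lift {C : Type u} [SmallCategory C] (o : D.V → C)
    (l : ∀ e, D.grp e → (o e ⟶ o e)) (x : ∀ {e f : D.V}, D.Edge e f → (o e ⟶ o f))
    (one : ∀ e, l e 1 = 𝟙 (o e)) (mul : ∀ e (g h : D.grp e), l e g ≫ l e h = l e (g * h))
    (comm : ∀ {e f : D.V} (y : D.Edge e f) (g : D.dom y), l e g ≫ x y = x y ≫ l f (D.φ y g)) :
    D.PresCat ⥤ C :=
  CategoryTheory.Quotient.lift _
    (Paths.lift (V := D.GenVert)
      { obj := o
        map := fun {e f} (y : Gen D e f) => match e, f, y with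
          | _, _, .loop g => l _ g
          | _, _, .edge y => x y })
    (by
      rintro _ _ _ _ (_ | ⟨g, h⟩ | ⟨y, g⟩)
      · exact (Paths.lift_toPath _ _).trans (one _)
      · rw [Functor.map_comp]
        erw [Paths.lift_toPath, Paths.lift_toPath, Paths.lift_toPath]
        exact mul _ g h
      · rw [Functor.map_comp, Functor.map_comp]
        erw [Paths.lift_toPath, Paths.lift_toPath, Paths.lift_toPath]
        exact comm y g)

section

variable {C : Type u} [SmallCategory C] (o : D.V → C)
    (l : ∀ e, D.grp e → (o e ⟶ o e)) (x : ∀ {e f : D.V}, D.Edge e f → (o e ⟶ o f))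
    (one : ∀ e, l e 1 = 𝟙 (o e)) (mul : ∀ e (g h : D.grp e), l e g ≫ l e h = l e (g * h))
    (comm : ∀ {e f : D.V} (y : D.Edge e f) (g : D.dom y), l e g ≫ x y = x y ≫ l f (D.φ y g))

theorem lift_loop {e : D.V} (g : D.grp e) :
    (lift o l x one mul comm).map (D.loop g) = l e g :=
  Paths.lift_toPath (V := D.GenVert) _ _

theorem lift_edge {e f : D.V} (y : D.Edge e f) :
    (lift o l x one mul comm).map (D.edge y) = x y :=
  Paths.lift_toPath (V := D.GenVert) _ _

end

/-- The arrow of `⟨D⟩` represented by an arrow of the free category. -/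
def ofPath {e f : D.V} (p : (Paths.of D.GenVert).obj e ⟶ (Paths.of D.GenVert).obj f) :
    D.obj e ⟶ D.obj f :=
  (Quotient.functor D.PresRel).map p

/-- Each arrow of `⟨D⟩` is a product `g₀ x₁ g₁ ⋯ xₙ gₙ` of loops and edges. -/
theorem hom_induction {P : ∀ {e f : D.V}, (D.obj e ⟶ D.obj f) → Prop}
    (loop : ∀ {e : D.V} (g : D.grp e), P (D.loop g))
    (step : ∀ {e f h : D.V} (g : D.grp e) (x : D.Edge e f) (a : D.obj f ⟶ D.obj h),
      P a → P (D.loop g ≫ D.edge x ≫ a)) {e f : D.V} (a : D.obj e ⟶ D.obj f) : P a := by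
  -- Allowing an extra loop on the left lets adjacent loops be merged before the next edge.
  have key : ∀ {e f : D.V} (p : (Paths.of D.GenVert).obj e ⟶ (Paths.of D.GenVert).obj f),
      P (ofPath p) ∧ ∀ g : D.grp e, P (D.loop g ≫ ofPath p) := by
    intro e f p
    refine Paths.induction' (V := D.GenVert)
      (fun {e f} p => P (e := e) (f := f) (ofPath p) ∧
        ∀ g : D.grp e, P (e := e) (f := f) (D.loop g ≫ ofPath p)) ?_ ?_ p
    · intro (e : D.V)
      change P (𝟙 (D.obj e)) ∧ ∀ g : D.grp e, P (D.loop g ≫ 𝟙 (D.obj e))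
      refine ⟨?_, fun g => ?_⟩
      · rw [← loop_one]
        exact loop _
      · rw [Category.comp_id]
        exact loop _
    · intro (e : D.V) (f : D.V) (h : D.V) (y : Gen D e f) q hq
      obtain ⟨h1, h2⟩ := hq
      cases y with
      | loop k =>
        change P (D.loop k ≫ ofPath q) ∧ ∀ g : D.grp e, P (D.loop g ≫ D.loop k ≫ ofPath q)
        refine ⟨h2 k, fun g => ?_⟩
        rw [← loop_mul_assoc]
        exact h2 _
      | edge x =>
        change P (D.edge x ≫ ofPath q) ∧ ∀ g : D.grp e, P (D.loop g ≫ D.edge x ≫ ofPath q)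
        refine ⟨?_, fun g => step g x _ h1⟩
        have := step (1 : D.grp e) x _ h1
        rwa [loop_one, Category.id_comp] at this
  obtain ⟨p, rfl⟩ := (Quotient.functor D.PresRel).map_surjective (X := (Paths.of D.GenVert).obj e)
    (Y := (Paths.of D.GenVert).obj f) a
  exact (key p).1

end Presentation

/-! ### Normal forms -/

/-- Normal forms of the arrows of `⟨D⟩`: a vertex group element, or a coset of the domain of an
edge, followed by this edge and a normal form. -/
inductive NF (D : PartialIsoDiagram.{u}) : D.V → D.V → Type u
  | nil {e : D.V} (g : D.grp e) : NF D e e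
  | cons {e f h : D.V} (x : D.Edge e f) (q : D.grp e ⧸ D.dom x) (r : NF D f h) : NF D e h

variable {D : PartialIsoDiagram.{u}}

/-- The element `k` of the domain of `x` with `g s = t k`, where `s` and `t` are the
representatives of the cosets `q` and `gq`. -/
noncomputable def cocycle {e f : D.V} (x : D.Edge e f) (g : D.grp e) (q : D.grp e ⧸ D.dom x) :
    D.dom x :=
  ⟨(g • q).out⁻¹ * (g * q.out), by
    rw [← QuotientGroup.eq, QuotientGroup.out_eq', ← smul_eq_mul, ← MulAction.Quotient.smul_coe,
      QuotientGroup.out_eq']⟩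

theorem out_mul_cocycle {e f : D.V} (x : D.Edge e f) (g : D.grp e) (q : D.grp e ⧸ D.dom x) :
    (g • q).out * (cocycle x g q : D.grp e) = g * q.out := by
  simp [cocycle]

/-- This cocycle identity is what makes `NF.smul` an action. -/
theorem cocycle_mul {e f : D.V} (x : D.Edge e f) (g h : D.grp e) (q : D.grp e ⧸ D.dom x) :
    cocycle x (g * h) q = cocycle x g (h • q) * cocycle x h q := by
  apply Subtype.ext
  simp only [cocycle, mul_smul, Subgroup.coe_mul]
  group

theorem cocycle_one {e f : D.V} (x : D.Edge e f) (q : D.grp e ⧸ D.dom x) :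
    cocycle x 1 q = 1 := by
  apply Subtype.ext
  simp [cocycle]

namespace NF

/-- Left multiplication of a normal form by an element of a vertex group. -/
noncomputable def smul : ∀ {e f : D.V}, D.grp e → NF D e f → NF D e f
  | _, _, g, nil k => nil (g * k)
  | _, _, g, cons x q r => cons x (g • q) (smul (D.φ x (cocycle x g q) : D.grp _) r)

theorem smul_one {e f : D.V} (n : NF D e f) : smul 1 n = n := by
  induction n with
  | nil g => simp [smul]
  | cons x q r ih => simp [smul, cocycle_one, ih]

theorem smul_mul {e f : D.V} (n : NF D e f) (g h : D.grp e) :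
    smul (g * h) n = smul g (smul h n) := by
  induction n with
  | nil k => simp [smul, mul_assoc]
  | cons x q r ih => simp [smul, cocycle_mul, ih, mul_smul]

/-- Product of normal forms. -/
noncomputable def mul : ∀ {e f h : D.V}, NF D e f → NF D f h → NF D e h
  | _, _, _, nil g, n => smul g n
  | _, _, _, cons x q r, n => cons x q (mul r n)

theorem mul_smul {e f h : D.V} (m : NF D e f) (n : NF D f h) (g : D.grp e) :
    mul (smul g m) n = smul g (mul m n) := by
  induction m with
  | nil k => simp [smul, mul, smul_mul]
  | cons x q r ih => simp [smul, mul, ih]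

theorem mul_assoc {e f h k : D.V} (l : NF D e f) (m : NF D f h) (n : NF D h k) :
    mul (mul l m) n = mul l (mul m n) := by
  induction l with
  | nil g => simp [mul, mul_smul]
  | cons x q r ih => simp [mul, ih]

theorem mul_one {e f : D.V} (m : NF D e f) : mul m (nil 1) = m := by
  induction m with
  | nil g => simp [mul, smul]
  | cons x q r ih => simp [mul, ih]

/-- The normal form of an identity. -/
def id (e : D.V) : NF D e e := nil 1

theorem cons_edge_inj {e f f' h : D.V} {x : D.Edge e f} {y : D.Edge e f'}
    {q : D.grp e ⧸ D.dom x} {q' : D.grp e ⧸ D.dom y} {r : NF D f h} {r' : NF D f' h}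
    (w : cons x q r = cons y q' r') : (⟨f, x⟩ : Σ f, D.Edge e f) = ⟨f', y⟩ := by
  injection w with _ hf _ hx
  subst hf
  rw [eq_of_heq hx]

theorem cons_inj {e f h : D.V} {x : D.Edge e f} {q q' : D.grp e ⧸ D.dom x} {r r' : NF D f h}
    (w : cons x q r = cons x q' r') : q = q' ∧ r = r' := by
  injection w with _ _ _ _ hq hr
  exact ⟨hq, hr⟩

/-- The number of edges in a normal form. -/
def length : ∀ {e f : D.V}, NF D e f → ℕ
  | _, _, nil _ => 0
  | _, _, cons _ _ r => length r + 1

theorem length_smul {e f : D.V} (n : NF D e f) (g : D.grp e) : length (smul g n) = length n := by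
  induction n with
  | nil k => simp [smul, length]
  | cons x q r ih => simp [smul, length, ih]

theorem length_mul {e f h : D.V} (m : NF D e f) (n : NF D f h) :
    length (mul m n) = length m + length n := by
  induction m with
  | nil k => simp [mul, length, length_smul]
  | cons x q r ih => simp [mul, length, ih]; omega

/-- The arrow of `⟨D⟩` with a given normal form. -/
noncomputable def arrow : ∀ {e f : D.V}, NF D e f → (D.obj e ⟶ D.obj f)
  | _, _, nil g => D.loop g
  | _, _, cons x q r => D.loop q.out ≫ D.edge x ≫ arrow r

/-- Moving g past the representative of q leaves the representative of gq and a cocycle value in the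
domain of φ_x, which then crosses x. -/
theorem arrow_smul {e f : D.V} (n : NF D e f) (g : D.grp e) :
    arrow (smul g n) = D.loop g ≫ arrow n := by
  induction n with
  | nil k => simp [smul, arrow, loop_mul]
  | cons x q r ih =>
    simp only [smul, arrow, ih]
    rw [← loop_comm_assoc, ← loop_mul_assoc, out_mul_cocycle, loop_mul_assoc]

/-- The normal form of an edge. -/
noncomputable def single {e f : D.V} (x : D.Edge e f) : NF D e f :=
  -- The chosen representative t of the trivial coset need not be 1, so x is written as t x
  -- φ_x(t⁻¹).
  cons x ((1 : D.grp e) : D.grp e ⧸ D.dom x)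
    (nil (D.φ x ⟨(((1 : D.grp e) : D.grp e ⧸ D.dom x)).out⁻¹, by
      simpa using QuotientGroup.eq.1
        (QuotientGroup.out_eq' ((1 : D.grp e) : D.grp e ⧸ D.dom x))⟩ : D.grp f))

theorem arrow_single {e f : D.V} (x : D.Edge e f) : arrow (single x) = D.edge x := by
  simp only [single, arrow]
  rw [← loop_comm, ← Category.assoc, loop_mul_inv, Category.id_comp]

theorem smul_single {e f : D.V} (x : D.Edge e f) (g : D.grp e) :
    ∃ h, smul g (single x) = cons x (g : D.grp e ⧸ D.dom x) (nil h) ∧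
      D.loop g ≫ D.edge x = D.loop (g : D.grp e ⧸ D.dom x).out ≫ D.edge x ≫ D.loop h := by
  have h1 : smul g (single x) = cons x (g • ((1 : D.grp e) : D.grp e ⧸ D.dom x)) (nil _) := rfl
  rw [MulAction.Quotient.smul_coe, smul_eq_mul, _root_.mul_one] at h1
  refine ⟨_, h1, ?_⟩
  have h2 := arrow_smul (single x) g
  rw [h1, arrow_single] at h2
  exact h2.symm

/-- The relation of `⟨D⟩` at an edge, verified on normal forms: with t the representative of the
trivial coset, both sides have tail φ_x(t⁻¹g). -/
theorem single_comm {e f : D.V} (x : D.Edge e f) (g : D.dom x) :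
    smul (g : D.grp e) (single x) = mul (single x) (nil (D.φ x g : D.grp f)) := by
  have hg : (g : D.grp e) • ((1 : D.grp e) : D.grp e ⧸ D.dom x) = ((1 : D.grp e) : _) := by
    rw [MulAction.Quotient.smul_coe, smul_eq_mul, _root_.mul_one]
    exact (QuotientGroup.eq.2 (by simp)).symm
  simp only [single, smul, mul]
  congr 2
  rw [← Subgroup.coe_mul, ← Subgroup.coe_mul, ← map_mul, ← map_mul]
  congr 2
  apply Subtype.ext
  simp [cocycle, hg, _root_.mul_assoc]

end NF

/-- The category of normal forms. -/
def NFCat (D : PartialIsoDiagram.{u}) : Type u := D.V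

noncomputable instance : SmallCategory D.NFCat where
  Hom e f := NF D e f
  id e := NF.id e
  comp m n := NF.mul m n
  id_comp m := NF.smul_one m
  comp_id m := NF.mul_one m
  assoc l m n := NF.mul_assoc l m n

/-- The functor that sends each arrow of `⟨D⟩` to its normal form. -/
noncomputable def toNF (D : PartialIsoDiagram.{u}) : D.PresCat ⥤ D.NFCat :=
  lift (C := D.NFCat) (fun e => e) (fun _ g => NF.nil g) (fun x => NF.single x)
    (fun _ => rfl) (fun _ _ _ => rfl) (fun x g => NF.single_comm x g)

/-- The normal form of an arrow. -/
noncomputable def nf {e f : D.V} (a : D.obj e ⟶ D.obj f) : NF D e f := D.toNF.map a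

theorem nf_loop {e : D.V} (g : D.grp e) : nf (D.loop g) = NF.nil g := lift_loop ..

theorem nf_edge {e f : D.V} (x : D.Edge e f) : nf (D.edge x) = NF.single x := lift_edge ..

theorem nf_comp {e f h : D.V} (a : D.obj e ⟶ D.obj f) (b : D.obj f ⟶ D.obj h) :
    nf (a ≫ b) = NF.mul (nf a) (nf b) := D.toNF.map_comp a b

/-- Only the coset of g stays in front of x; the remaining factor of g crosses x and becomes k. -/
theorem nf_step {e f h : D.V} (g : D.grp e) (x : D.Edge e f) (a : D.obj f ⟶ D.obj h) :
    ∃ k : D.grp f, nf (D.loop g ≫ D.edge x ≫ a) = NF.cons x (g : D.grp e ⧸ D.dom x)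
      (nf (D.loop k ≫ a)) ∧
      D.loop g ≫ D.edge x = D.loop (g : D.grp e ⧸ D.dom x).out ≫ D.edge x ≫ D.loop k := by
  obtain ⟨k, h1, h2⟩ := NF.smul_single x g
  refine ⟨k, ?_, h2⟩
  rw [nf_comp, nf_comp, nf_comp, nf_loop, nf_edge, nf_loop, ← NF.mul_assoc,
    show NF.mul (NF.nil g) (NF.single x) = _ from h1]
  rfl

/-- Makes `nf` injective, so that equations in `⟨D⟩` can be decided on normal forms. -/
theorem arrow_nf {e f : D.V} (a : D.obj e ⟶ D.obj f) : (nf a).arrow = a := by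
  induction a using hom_induction with
  | loop g => rw [nf_loop]; rfl
  | step g x a ih =>
    obtain ⟨k, h1, h2⟩ := nf_step g x a
    rw [h1, nf_comp, nf_loop]
    change D.loop _ ≫ D.edge x ≫ (NF.smul k (nf a)).arrow = _
    rw [NF.arrow_smul, ih, ← Category.assoc (D.loop g), h2]
    simp

theorem loop_injective {e : D.V} {g h : D.grp e} (w : D.loop g = D.loop h) : g = h := by
  have := congrArg nf w
  rw [nf_loop, nf_loop] at this
  exact NF.nil.inj this

theorem loop_comp_injective {e f : D.V} (g : D.grp e) {a b : D.obj e ⟶ D.obj f}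
    (w : D.loop g ≫ a = D.loop g ≫ b) : a = b :=
  (cancel_epi _).1 w

/-- Composing with x puts one edge in front of the normal form and acts on the rest by a fixed group
element, which can be undone. -/
theorem edge_comp_injective {e f h : D.V} (x : D.Edge e f) {a b : D.obj f ⟶ D.obj h}
    (w : D.edge x ≫ a = D.edge x ≫ b) : a = b := by
  have := congrArg nf w
  rw [nf_comp, nf_comp, nf_edge] at this
  have h2 : NF.smul _ (nf a) = NF.smul _ (nf b) := (NF.cons_inj this).2
  have h3 := congrArg NF.arrow h2
  rw [NF.arrow_smul, NF.arrow_smul, arrow_nf, arrow_nf] at h3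
  exact loop_comp_injective _ h3

theorem edge_eq_of_step_eq {e f f' h : D.V} {g g' : D.grp e} {x : D.Edge e f} {y : D.Edge e f'}
    {a : D.obj f ⟶ D.obj h} {b : D.obj f' ⟶ D.obj h}
    (w : D.loop g ≫ D.edge x ≫ a = D.loop g' ≫ D.edge y ≫ b) :
    (⟨f, x⟩ : Σ f, D.Edge e f) = ⟨f', y⟩ := by
  obtain ⟨k, h1, -⟩ := nf_step g x a
  obtain ⟨k', h1', -⟩ := nf_step g' y b
  rw [w, h1'] at h1
  exact (NF.cons_edge_inj h1).symm

/-- The first cosets agree, so k = g'⁻¹g lies in the domain of φ_x; carrying it across x and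
cancelling compares the tails. This is the tool for peeling off common first edges. -/
theorem exists_of_step_eq {e f h : D.V} {g g' : D.grp e} {x : D.Edge e f}
    {a b : D.obj f ⟶ D.obj h}
    (w : D.loop g ≫ D.edge x ≫ a = D.loop g' ≫ D.edge x ≫ b) :
    ∃ k : D.dom x, g = g' * k ∧ b = D.loop (D.φ x k : D.grp f) ≫ a := by
  have h0 : ((g' : D.grp e) : D.grp e ⧸ D.dom x) = g := by
    obtain ⟨k, h1, -⟩ := nf_step g x a
    obtain ⟨k', h1', -⟩ := nf_step g' x b
    rw [w, h1'] at h1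
    exact (NF.cons_inj h1).1
  refine ⟨⟨g'⁻¹ * g, QuotientGroup.eq.1 h0⟩, by simp, ?_⟩
  set k : D.dom x := ⟨g'⁻¹ * g, QuotientGroup.eq.1 h0⟩
  have hk : g = g' * k := by simp [k]
  rw [hk, loop_mul_assoc, loop_comm_assoc] at w
  exact (edge_comp_injective x (loop_comp_injective g' w)).symm

end PartialIsoDiagram

/-! ### Atoms and factorization in Rees categories -/

section ReesCategories

variable {C : Type u} [SmallCategory C]

theorem principalRightIdeal_subset_iff {X Y Z : C} (a : X ⟶ Y) (b : X ⟶ Z) :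
    principalRightIdeal a ⊆ principalRightIdeal b ↔ ∃ k, a = b ≫ k := by
  constructor
  · intro h
    exact h (show (⟨Y, a⟩ : Σ Z : C, X ⟶ Z) ∈ principalRightIdeal a from ⟨𝟙 _, by simp⟩)
  · rintro ⟨k, rfl⟩ ⟨W, p⟩ ⟨c, hc⟩
    exact ⟨k ≫ c, by rw [hc, Category.assoc]⟩

theorem principalRightIdeal_inter_nonempty_iff {X Y Z : C} (a : X ⟶ Y) (b : X ⟶ Z) :
    (principalRightIdeal a ∩ principalRightIdeal b).Nonempty ↔
      ∃ (W : C) (c : Y ⟶ W) (d : Z ⟶ W), a ≫ c = b ≫ d := by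
  constructor
  · rintro ⟨⟨W, p⟩, ⟨c, hc⟩, ⟨d, hd⟩⟩
    exact ⟨W, c, d, hc.symm.trans hd⟩
  · rintro ⟨W, c, d, h⟩
    exact ⟨⟨W, a ≫ c⟩, ⟨c, rfl⟩, ⟨d, h⟩⟩

theorem IsAtomArrow.conj {X Y X' Y' : C} {a : X ⟶ Y} (ha : IsAtomArrow a) (p : X' ⟶ X)
    (q : Y ⟶ Y') [IsIso p] [IsIso q] : IsAtomArrow (p ≫ a ≫ q) := by
  refine ⟨fun h => ha.1 ?_, fun Z b c h => ?_⟩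
  · have : a = inv p ≫ (p ≫ a ≫ q) ≫ inv q := by simp
    rw [this]
    infer_instance
  · rcases ha.2 Z (inv p ≫ b) (c ≫ inv q) (by
      rw [Category.assoc, ← Category.assoc b, ← h]; simp) with h | h
    · left
      have : b = p ≫ inv p ≫ b := by simp
      rw [this]
      infer_instance
    · right
      have : c = (c ≫ inv q) ≫ q := by simp
      rw [this]
      infer_instance

theorem greenJ_conj {X Y X' Y' : C} (a : X ⟶ Y) (p : X' ⟶ X) (q : Y ⟶ Y') [IsIso p] [IsIso q] :
    GreenJ (p ≫ a ≫ q) a :=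
  ⟨⟨p, q, rfl⟩, ⟨inv p, inv q, by simp⟩⟩

theorem GreenJ.refl {X Y : C} (a : X ⟶ Y) : GreenJ a a :=
  ⟨⟨𝟙 _, 𝟙 _, by simp⟩, ⟨𝟙 _, 𝟙 _, by simp⟩⟩

theorem GreenJ.symm {X Y X' Y' : C} {a : X ⟶ Y} {b : X' ⟶ Y'} (h : GreenJ a b) : GreenJ b a :=
  ⟨h.2, h.1⟩

theorem GreenJ.trans {X Y X' Y' X'' Y'' : C} {a : X ⟶ Y} {b : X' ⟶ Y'} {c : X'' ⟶ Y''}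
    (h : GreenJ a b) (k : GreenJ b c) : GreenJ a c :=
  ⟨h.1.trans k.1, k.2.trans h.2⟩

namespace IsReesCategory

variable (hC : IsReesCategory C)
include hC

/-- From fg = 1 follows (gf)g = g, and g can be cancelled on the right. -/
theorem isIso_of_comp_eq_id {X Y : C} {f : X ⟶ Y} {g : Y ⟶ X} (h : f ≫ g = 𝟙 X) :
    IsIso f := by
  refine ⟨g, h, hC.rightCancellative _ _ _ _ _ g ?_⟩
  rw [Category.assoc, h, Category.comp_id, Category.id_comp]

theorem isIso_of_isIso_comp {X Y Z : C} (f : X ⟶ Y) (g : Y ⟶ Z) [IsIso (f ≫ g)] :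
    IsIso f ∧ IsIso g := by
  have hf : IsIso f := hC.isIso_of_comp_eq_id (g := g ≫ inv (f ≫ g)) (by
    rw [← Category.assoc, IsIso.hom_inv_id])
  exact ⟨hf, IsIso.of_isIso_comp_left f g⟩

/-- A factorization of an atom has at most one non-invertible factor, and here it is b. In
particular, J-related atoms differ by invertible arrows at their two ends. -/
theorem isIso_of_atom_eq {X Y X' Y' : C} {a : X ⟶ Y} {b : X' ⟶ Y'} (ha : IsAtomArrow a)
    (hb : ¬ IsIso b) {p : X ⟶ X'} {q : Y' ⟶ Y} (h : a = p ≫ b ≫ q) : IsIso p ∧ IsIso q := by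
  constructor
  · refine (ha.2 _ p (b ≫ q) h).resolve_right fun h => hb ?_
    exact (hC.isIso_of_isIso_comp b q).1
  · refine (ha.2 _ (p ≫ b) q (by rw [h, Category.assoc])).resolve_left fun h => hb ?_
    exact (hC.isIso_of_isIso_comp p b).2

/-- Induction on arrows: each arrow of a Rees category is a product of invertible arrows and
atoms. -/
theorem arrow_induction {P : ∀ {X Y : C}, (X ⟶ Y) → Prop}
    (iso : ∀ {X Y : C} (a : X ⟶ Y), IsIso a → P a)
    (atom : ∀ {X Y : C} (a : X ⟶ Y), IsAtomArrow a → P a)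
    (comp : ∀ {X Y Z : C} (a : X ⟶ Y) (b : Y ⟶ Z), P a → P b → P (a ≫ b))
    {X Y : C} (a : X ⟶ Y) : P a := by
  let S : ∀ {X Y : C}, (X ⟶ Y) → Set (Set (Σ Z : C, X ⟶ Z)) := fun {X Y} a =>
    {I | (∃ (Z : C) (b : X ⟶ Z), I = principalRightIdeal b) ∧ principalRightIdeal a ⊂ I}
  have hS : ∀ {X Y : C} (a : X ⟶ Y), (S a).Finite := fun a => hC.finite_above _ _ a
  have mem : ∀ {X Y Z : C} (b : X ⟶ Y) (c : Y ⟶ Z), ¬ IsIso c →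
      principalRightIdeal b ∈ S (b ≫ c) := by
    intro X Y Z b c hc
    refine ⟨⟨_, b, rfl⟩, (principalRightIdeal_subset_iff _ _).2 ⟨c, rfl⟩, fun h => hc ?_⟩
    obtain ⟨k, hk⟩ := (principalRightIdeal_subset_iff _ _).1 h
    refine hC.isIso_of_comp_eq_id (g := k) (hC.leftCancellative _ _ _ b _ _ ?_)
    rw [← Category.assoc, ← hk, Category.comp_id]
  -- The induction is on the number of principal right ideals properly above aC.
  generalize hn : (S a).ncard = n
  induction n using Nat.strong_induction_on generalizing X Y with
  | _ n ih =>
    subst hn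
    by_cases ha : IsIso a
    · exact iso a ha
    by_cases ha' : IsAtomArrow a
    · exact atom a ha'
    have : ∃ (Z : C) (b : X ⟶ Z) (c : Z ⟶ Y), a = b ≫ c ∧ ¬ IsIso b ∧ ¬ IsIso c := by
      by_contra! h
      exact ha' ⟨ha, fun Z b c hbc => or_iff_not_imp_left.2 (h Z b c hbc)⟩
    obtain ⟨Z, b, c, rfl, hb, hc⟩ := this
    refine comp b c (ih _ ?_ b rfl) (ih _ ?_ c rfl)
    -- The ideal bC lies properly above bcC, but not properly above itself.
    · refine Set.ncard_lt_ncard ⟨?_, fun h => (h (mem b c hc)).2.2 subset_rfl⟩ (hS _)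
      rintro I ⟨h1, h2⟩
      exact ⟨h1, ((principalRightIdeal_subset_iff _ _).2 ⟨c, rfl⟩).trans_ssubset h2⟩
    -- Left multiplication by b embeds the ideals properly above cC in those properly above bcC. The
    -- image misses the ideal of the identity because b is not invertible.
    · let m : (Σ W : C, Z ⟶ W) → (Σ W : C, X ⟶ W) := fun p => ⟨p.1, b ≫ p.2⟩
      have hm : Function.Injective m := by
        rintro ⟨W, p⟩ ⟨W', p'⟩ h
        obtain rfl : W = W' := congrArg Sigma.fst h
        have h' : b ≫ p = b ≫ p' := eq_of_heq (Sigma.mk.inj h).2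
        rw [hC.leftCancellative _ _ _ b _ _ h']
      have him : ∀ {W : C} (d : Z ⟶ W),
          m '' principalRightIdeal d = principalRightIdeal (b ≫ d) := by
        intro W d
        apply Set.Subset.antisymm
        · rintro _ ⟨⟨V, q⟩, ⟨k, hk⟩, rfl⟩
          change W ⟶ V at k
          change q = d ≫ k at hk
          subst hk
          exact ⟨k, (Category.assoc _ _ _).symm⟩
        · rintro ⟨V, p⟩ ⟨k, hk⟩
          change W ⟶ V at k
          change p = (b ≫ d) ≫ k at hk
          subst hk
          exact ⟨⟨V, d ≫ k⟩, ⟨k, rfl⟩, by simp [m]⟩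
      rw [← Set.ncard_image_of_injective _ (Set.image_injective.2 hm)]
      refine Set.ncard_lt_ncard ⟨?_, fun h => ?_⟩ (hS _)
      · rintro _ ⟨I, ⟨⟨W, d, rfl⟩, h⟩, rfl⟩
        refine ⟨⟨W, b ≫ d, him d⟩, ?_⟩
        rw [← him]
        exact hm.image_strictMono h
      · have h1 : principalRightIdeal (𝟙 X) ∈ S (b ≫ c) := by
          refine ⟨⟨_, _, rfl⟩, (principalRightIdeal_subset_iff _ _).2 ⟨b ≫ c, by simp⟩,
            fun h => ha ?_⟩
          obtain ⟨k, hk⟩ := (principalRightIdeal_subset_iff _ _).1 h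
          exact hC.isIso_of_comp_eq_id hk.symm
        obtain ⟨I, ⟨⟨W, d, rfl⟩, -⟩, h⟩ := h h1
        rw [him] at h
        obtain ⟨k, hk⟩ := (principalRightIdeal_subset_iff _ _).1 h.ge
        rw [Category.assoc] at hk
        exact hb (hC.isIso_of_comp_eq_id hk.symm)

end IsReesCategory

end ReesCategories

namespace PartialIsoDiagram

/-! ### The length of an arrow of `⟨D⟩` -/

section Length

variable {D : PartialIsoDiagram.{u}}

/-- The vertex of an object of `⟨D⟩`. -/
def vertex (X : D.PresCat) : D.V := X.as

theorem obj_injective : Function.Injective D.obj := fun _ _ h => congrArg vertex h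

theorem obj_surjective (X : D.PresCat) : ∃ e, D.obj e = X := ⟨vertex X, rfl⟩

/-- The number of edges in an arrow of `⟨D⟩`. -/
noncomputable def length {X Y : D.PresCat} (a : X ⟶ Y) : ℕ :=
  (nf (e := X.as) (f := Y.as) a).length

theorem length_loop {e : D.V} (g : D.grp e) : length (D.loop g) = 0 := by
  change (nf (D.loop g)).length = 0
  rw [nf_loop]; rfl

theorem length_edge {e f : D.V} (x : D.Edge e f) : length (D.edge x) = 1 := by
  change (nf (D.edge x)).length = 1
  rw [nf_edge]; rfl

theorem length_comp {X Y Z : D.PresCat} (a : X ⟶ Y) (b : Y ⟶ Z) :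
    length (a ≫ b) = length a + length b := by
  obtain ⟨e, rfl⟩ := obj_surjective X
  obtain ⟨f, rfl⟩ := obj_surjective Y
  obtain ⟨h, rfl⟩ := obj_surjective Z
  change (nf (a ≫ b)).length = _
  rw [nf_comp, NF.length_mul]
  rfl

theorem length_id (X : D.PresCat) : length (𝟙 X) = 0 := by
  have := length_comp (𝟙 X) (𝟙 X)
  rw [Category.comp_id] at this
  omega

theorem length_step {e f : D.V} {X : D.PresCat} (g : D.grp e) (x : D.Edge e f)
    (a : D.obj f ⟶ X) : length (D.loop g ≫ D.edge x ≫ a) = length a + 1 := by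
  rw [length_comp, length_comp, length_loop, length_edge]
  omega

theorem eq_of_length_eq_zero {e f : D.V} {a : D.obj e ⟶ D.obj f} (h : length a = 0) : e = f := by
  induction a using hom_induction with
  | loop g => rfl
  | step g x a ih => rw [length_step] at h; omega

theorem exists_loop_of_length_eq_zero {e : D.V} {a : D.obj e ⟶ D.obj e} (h : length a = 0) :
    ∃ g, a = D.loop g := by
  change (nf a).length = 0 at h
  rw [← arrow_nf a]
  cases hn : nf a with
  | nil g => exact ⟨g, rfl⟩
  | cons x q r => rw [hn] at h; simp [NF.length] at h

theorem exists_step_of_length_ne_zero {e f : D.V} {a : D.obj e ⟶ D.obj f} (h : length a ≠ 0) :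
    ∃ (e' : D.V) (g : D.grp e) (x : D.Edge e e') (b : D.obj e' ⟶ D.obj f),
      a = D.loop g ≫ D.edge x ≫ b := by
  induction a using hom_induction with
  | loop g => exact absurd (length_loop g) h
  | step g x a ih => exact ⟨_, g, x, a, rfl⟩

/-- Lengths add up and identities have length zero; conversely an arrow of length zero is a loop. -/
theorem isIso_iff_length_eq_zero {X Y : D.PresCat} (a : X ⟶ Y) : IsIso a ↔ length a = 0 := by
  constructor
  · intro _
    have := length_comp a (inv a)
    rw [IsIso.hom_inv_id, length_id] at this
    omega
  · intro h
    obtain ⟨e, rfl⟩ := obj_surjective X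
    obtain ⟨f, rfl⟩ := obj_surjective Y
    obtain rfl : e = f := eq_of_length_eq_zero h
    obtain ⟨g, rfl⟩ := exists_loop_of_length_eq_zero h
    exact (D.loopIso g).isIso_hom

/-- Cut an atom after its first edge: the front factor has positive length, so the remaining factor
is invertible and has length zero. -/
theorem isAtomArrow_iff_length_eq_one {X Y : D.PresCat} (a : X ⟶ Y) :
    IsAtomArrow a ↔ length a = 1 := by
  constructor
  · rintro ⟨h1, h2⟩
    obtain ⟨e, rfl⟩ := obj_surjective X
    obtain ⟨f, rfl⟩ := obj_surjective Y
    rw [isIso_iff_length_eq_zero] at h1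
    obtain ⟨e', g, x, b, rfl⟩ := exists_step_of_length_ne_zero h1
    rw [length_step]
    have := h2 (D.obj e') (D.loop g ≫ D.edge x) b (by rw [Category.assoc])
    rw [isIso_iff_length_eq_zero, isIso_iff_length_eq_zero, length_comp, length_edge] at this
    omega
  · intro h
    refine ⟨by rw [isIso_iff_length_eq_zero]; omega, ?_⟩
    rintro Z b c rfl
    rw [length_comp] at h
    rw [isIso_iff_length_eq_zero, isIso_iff_length_eq_zero]
    omega

theorem isAtomArrow_edge {e f : D.V} (x : D.Edge e f) : IsAtomArrow (D.edge x) :=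
  (isAtomArrow_iff_length_eq_one _).2 (length_edge x)

theorem exists_of_isAtomArrow {e f : D.V} {a : D.obj e ⟶ D.obj f} (ha : IsAtomArrow a) :
    ∃ (g : D.grp e) (x : D.Edge e f) (h : D.grp f), a = D.loop g ≫ D.edge x ≫ D.loop h := by
  rw [isAtomArrow_iff_length_eq_one] at ha
  obtain ⟨e', g, x, b, rfl⟩ := exists_step_of_length_ne_zero (a := a) (by omega)
  rw [length_step] at ha
  obtain rfl : e' = f := eq_of_length_eq_zero (a := b) (by omega)
  obtain ⟨h, rfl⟩ := exists_loop_of_length_eq_zero (a := b) (by omega)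
  exact ⟨g, x, h, rfl⟩

theorem edge_injective_of_conj {e f : D.V} {x y : D.Edge e f} {g g' : D.grp e} {h h' : D.grp f}
    (w : D.loop g ≫ D.edge x ≫ D.loop h = D.loop g' ≫ D.edge y ≫ D.loop h') : x = y :=
  eq_of_heq (Sigma.mk.inj (edge_eq_of_step_eq w)).2

/-- No relation gx = xh holds beyond the imposed ones, because the first coset of an arrow is
determined. Hence the partial isomorphisms can be read off from the category. -/
theorem maps_iff {e f : D.V} (x : D.Edge e f) (g : D.grp e) (h : D.grp f) :
    D.Maps x g h ↔ D.loop g ≫ D.edge x = D.edge x ≫ D.loop h := by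
  constructor
  · rintro ⟨hg, rfl⟩
    exact D.loop_comm x ⟨g, hg⟩
  · intro w
    have w' : D.loop g ≫ D.edge x ≫ D.loop 1 = D.loop 1 ≫ D.edge x ≫ D.loop h := by
      rw [loop_one, loop_one, Category.comp_id, Category.id_comp, w]
    obtain ⟨k, h1, h2⟩ := exists_of_step_eq w'
    rw [one_mul] at h1
    rw [loop_one, Category.comp_id] at h2
    refine ⟨h1 ▸ k.2, ?_⟩
    rw [loop_injective h2]
    congr

end Length

/-! ### `⟨D⟩` is a Rees category, and a Serre category if D is a Serre diagram -/

section Rees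

variable (D : PartialIsoDiagram.{u})

theorem leftCancellative_presCat : LeftCancellative D.PresCat := by
  intro X Y Z a x y w
  obtain ⟨e, rfl⟩ := obj_surjective X
  obtain ⟨f, rfl⟩ := obj_surjective Y
  induction a using hom_induction with
  | loop g => exact loop_comp_injective g w
  | step g z a ih =>
    rw [Category.assoc, Category.assoc, Category.assoc, Category.assoc] at w
    exact ih _ _ (edge_comp_injective z (loop_comp_injective g w))

/-- Here injectivity of φ_x enters: it settles the case of two loops. Longer arrows are compared by
peeling off their first edges, the discrepancy k being moved into the tail. -/
theorem comp_edge_injective {e f h : D.V} (x : D.Edge f h) (a b : D.obj e ⟶ D.obj f)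
    (w : a ≫ D.edge x = b ≫ D.edge x) : a = b := by
  have hl : length a = length b := by
    have := congrArg length w
    rw [length_comp, length_comp] at this
    omega
  induction a using hom_induction with
  | loop g =>
    rw [length_loop] at hl
    obtain ⟨g', rfl⟩ := exists_loop_of_length_eq_zero hl.symm
    have w' : D.loop g ≫ D.edge x ≫ D.loop 1 = D.loop g' ≫ D.edge x ≫ D.loop 1 := by
      rw [loop_one, Category.comp_id, w]
    obtain ⟨k, h1, h2⟩ := exists_of_step_eq w'
    rw [loop_one, Category.comp_id, ← loop_one] at h2
    have hk : k = 1 := (D.φ x).injective (by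
      rw [map_one]; exact Subtype.ext (loop_injective h2).symm)
    rw [h1, hk, Subgroup.coe_one, mul_one]
  | step g y a ih =>
    rw [length_step] at hl
    obtain ⟨e', g', z, b, rfl⟩ := exists_step_of_length_ne_zero (a := b) (by omega)
    rw [length_step] at hl
    simp only [Category.assoc] at w
    obtain h := edge_eq_of_step_eq w
    cases h
    obtain ⟨k, h1, h2⟩ := exists_of_step_eq w
    rw [← Category.assoc] at h2
    have := ih x (D.loop (D.φ y k)⁻¹ ≫ b) (by
      rw [Category.assoc, h2]
      simp only [Category.assoc]
      rw [loop_inv_mul_assoc]) (by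
      rw [length_comp, length_loop]; omega)
    rw [this, h1, loop_mul_assoc, loop_comm_assoc, loop_mul_inv_assoc]

theorem rightCancellative_presCat : RightCancellative D.PresCat := by
  intro X Y Z x y a w
  obtain ⟨e, rfl⟩ := obj_surjective X
  obtain ⟨f, rfl⟩ := obj_surjective Y
  obtain ⟨h, rfl⟩ := obj_surjective Z
  induction a using hom_induction with
  | loop g => exact (cancel_mono _).1 w
  | step g z a ih =>
    have := ih (x ≫ D.loop g ≫ D.edge z) (y ≫ D.loop g ≫ D.edge z)
      (by simpa only [Category.assoc] using w)
    rw [← Category.assoc, ← Category.assoc] at this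
    exact (cancel_mono _).1 (comp_edge_injective D z _ _ this)

variable {D} in
-- Equal products have the same first edge, which can be cancelled until a or b has no edges left;
-- that one is then invertible and divides the other.
theorem exists_factor_of_comp_eq {e f f' h : D.V} {a : D.obj e ⟶ D.obj f}
    {b : D.obj e ⟶ D.obj f'} {c : D.obj f ⟶ D.obj h} {d : D.obj f' ⟶ D.obj h}
    (w : a ≫ c = b ≫ d) : (∃ k, a = b ≫ k) ∨ ∃ k, b = a ≫ k := by
  induction a using hom_induction with
  | loop g => exact Or.inr ⟨D.loop g⁻¹ ≫ b, by
      rw [loop_mul_inv_assoc]⟩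
  | step g x a ih =>
    by_cases hb : length b = 0
    · left
      have := (isIso_iff_length_eq_zero b).2 hb
      exact ⟨inv b ≫ D.loop g ≫ D.edge x ≫ a, by rw [IsIso.hom_inv_id_assoc]⟩
    · obtain ⟨e', g', y, b, rfl⟩ := exists_step_of_length_ne_zero hb
      simp only [Category.assoc] at w
      have hxy := edge_eq_of_step_eq w
      cases hxy
      obtain ⟨k, h1, h2⟩ := exists_of_step_eq w
      rw [h1, loop_mul_assoc, loop_comm_assoc]
      rcases ih (b := D.loop (D.φ x k)⁻¹ ≫ b) (by
        rw [Category.assoc, h2, loop_inv_mul_assoc]) with ⟨l, hl⟩ | ⟨l, hl⟩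
      · left
        exact ⟨l, by
          rw [hl, Category.assoc, loop_mul_inv_assoc]
          simp⟩
      · right
        refine ⟨l, ?_⟩
        simp only [Category.assoc]
        rw [← hl, loop_mul_inv_assoc]

theorem isReesCategory_presCat : IsReesCategory D.PresCat where
  leftCancellative := D.leftCancellative_presCat
  rightCancellative := D.rightCancellative_presCat
  rightRigid := by
    intro X Y Z a b h
    obtain ⟨e, rfl⟩ := obj_surjective X
    obtain ⟨f, rfl⟩ := obj_surjective Y
    obtain ⟨f', rfl⟩ := obj_surjective Z
    obtain ⟨W, c, d, w⟩ := (principalRightIdeal_inter_nonempty_iff a b).1 h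
    obtain ⟨k, rfl⟩ := obj_surjective W
    rw [principalRightIdeal_subset_iff, principalRightIdeal_subset_iff]
    exact exists_factor_of_comp_eq w
  finite_above := by
    intro X Y a
    -- The left factors of a of a given length n generate at most one ideal: of two such factors one
    -- divides the other, with a quotient of length zero. So the ideals above aC number at most one
    -- for each length up to that of a.
    have hfin : (⋃ n ∈ Set.Iic (length a), {I : Set (Σ Z : D.PresCat, X ⟶ Z) |
        ∃ (Z : D.PresCat) (b : X ⟶ Z), I = principalRightIdeal b ∧ length b = n ∧
          ∃ c, a = b ≫ c}).Finite := by
      refine (Set.finite_Iic _).biUnion fun n _ => Set.Subsingleton.finite ?_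
      rintro _ ⟨Z, b, rfl, hb, c, hc⟩ _ ⟨Z', b', rfl, hb', c', hc'⟩
      have key : ∀ {Z Z' : D.PresCat} (b : X ⟶ Z) (b' : X ⟶ Z') (k : Z' ⟶ Z),
          length b = length b' → b = b' ≫ k →
            principalRightIdeal b = principalRightIdeal b' := by
        intro Z Z' b b' k hl h
        have h' := congrArg length h
        rw [length_comp] at h'
        have : IsIso k := (isIso_iff_length_eq_zero k).2 (by omega)
        exact ((principalRightIdeal_subset_iff _ _).2 ⟨k, h⟩).antisymm
          ((principalRightIdeal_subset_iff _ _).2 ⟨inv k, by rw [h]; simp⟩)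
      rcases exists_factor_of_comp_eq (e := X.as) (f := Z.as) (f' := Z'.as) (h := Y.as)
        (hc.symm.trans hc') with ⟨k, h⟩ | ⟨k, h⟩
      · exact key b b' k (hb.trans hb'.symm) h
      · exact (key b' b k (hb'.trans hb.symm) h).symm
    refine hfin.subset ?_
    rintro _ ⟨⟨Z, b, rfl⟩, h⟩
    obtain ⟨c, hc⟩ := (principalRightIdeal_subset_iff _ _).1 h.1
    refine Set.mem_biUnion (x := length b) ?_ ⟨Z, b, rfl, rfl, c, hc⟩
    rw [Set.mem_Iic, hc, length_comp]
    omega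

theorem skeletal_presCat : Skeletal D.PresCat := by
  rintro X Y ⟨i⟩
  obtain ⟨e, rfl⟩ := obj_surjective X
  obtain ⟨f, rfl⟩ := obj_surjective Y
  obtain rfl : e = f :=
    eq_of_length_eq_zero ((isIso_iff_length_eq_zero i.hom).1 inferInstance)
  rfl

/-- The edges of `D` represent the `J`-classes of atoms of `⟨D⟩`. -/
theorem existsUnique_edge_of_isAtomArrow {e f : D.V} (a : D.obj e ⟶ D.obj f)
    (ha : IsAtomArrow a) : ∃! x : D.Edge e f, GreenJ a (D.edge x) := by
  obtain ⟨g, x, h, rfl⟩ := exists_of_isAtomArrow ha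
  have hx := greenJ_conj (D.edge x) (D.loop g) (D.loop h)
  refine ⟨x, hx, fun y hy => ?_⟩
  -- J-equivalence gives y = pxq with p, q invertible, hence loops; comparing first edges gives y =
  -- x.
  obtain ⟨⟨p, q, hpq⟩, -⟩ := hy.symm.trans hx
  obtain ⟨h1, h2⟩ := D.isReesCategory_presCat.isIso_of_atom_eq (isAtomArrow_edge y)
    (isAtomArrow_edge x).1 hpq
  rw [isIso_iff_length_eq_zero] at h1 h2
  obtain ⟨p, rfl⟩ := exists_loop_of_length_eq_zero h1
  obtain ⟨q, rfl⟩ := exists_loop_of_length_eq_zero h2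
  refine edge_injective_of_conj (g := 1) (g' := p) (h := 1) (h' := q) ?_
  rw [loop_one, loop_one, Category.comp_id, Category.id_comp]
  exact hpq

variable {D} in
theorem IsSerre.isSerreCategory (hD : D.IsSerre) : IsSerreCategory D.PresCat where
  toIsReesCategory := D.isReesCategory_presCat
  skeletal := D.skeletal_presCat
  finite_obj := by
    have := hD.finite_vertices
    exact Finite.of_surjective D.obj fun X => ⟨vertex X, rfl⟩
  nonempty_obj := hD.nonempty_vertices.map D.obj
  finite_atoms := by
    intro X Y
    obtain ⟨e, rfl⟩ := obj_surjective X
    obtain ⟨f, rfl⟩ := obj_surjective Y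
    have := hD.finite_edges e f
    refine Finite.of_surjective (fun x : D.Edge e f =>
      (Quotient.mk (atomSetoid (D.obj e) (D.obj f)) ⟨D.edge x, isAtomArrow_edge x⟩)) ?_
    intro q
    obtain ⟨⟨a, ha⟩, rfl⟩ := Quotient.exists_rep q
    obtain ⟨x, hx, -⟩ := D.existsUnique_edge_of_isAtomArrow a ha
    exact ⟨x, Quotient.sound hx.symm⟩
  connected := by
    intro X Y
    obtain ⟨e, rfl⟩ := obj_surjective X
    obtain ⟨f, rfl⟩ := obj_surjective Y
    induction hD.connected e f with
    | rel e f h => exact Zigzag.of_hom (D.edge h.some)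
    | refl e => exact Zigzag.refl _
    | symm _ _ _ ih => exact ih.symm
    | trans _ _ _ _ _ ih1 ih2 => exact ih1.trans ih2

end Rees

end PartialIsoDiagram

/-- By rigidity one of the two atoms is a left factor of the other, and the quotient is invertible
since both are atoms. This is the uniqueness of the first atom of an arrow. -/
theorem IsReesCategory.exists_isIso_of_atom_comp_eq {C : Type u} [SmallCategory C]
    (hC : IsReesCategory C) {X Y Y' W : C} {a : X ⟶ Y} {a' : X ⟶ Y'} (ha : IsAtomArrow a)
    (ha' : IsAtomArrow a') {c : Y ⟶ W} {d : Y' ⟶ W} (w : a ≫ c = a' ≫ d) :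
    ∃ k : Y' ⟶ Y, IsIso k ∧ a = a' ≫ k := by
  have h := hC.rightRigid _ _ _ a a'
    ((principalRightIdeal_inter_nonempty_iff a a').2 ⟨W, c, d, w⟩)
  rw [principalRightIdeal_subset_iff, principalRightIdeal_subset_iff] at h
  rcases h with ⟨k, h⟩ | ⟨k, h⟩
  · exact ⟨k, (ha.2 _ a' k h).resolve_left ha'.1, h⟩
  · have := (ha'.2 _ a k h).resolve_left ha.1
    exact ⟨inv k, inferInstance, by rw [h]; simp⟩

/-! ### Functors from `⟨D⟩` and a criterion for isomorphism -/

namespace PartialIsoDiagram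

/-- A functor from `⟨D⟩` to `C`, as a function of the vertices of `D` and of the arrows between
them. -/
structure Realization (D : PartialIsoDiagram.{u}) (C : Type u) [SmallCategory C] where
  obj : D.V → C
  map : ∀ {e f : D.V}, (D.obj e ⟶ D.obj f) → (obj e ⟶ obj f)
  map_id : ∀ e, map (𝟙 (D.obj e)) = 𝟙 (obj e)
  map_comp : ∀ {e f h : D.V} (a : D.obj e ⟶ D.obj f) (b : D.obj f ⟶ D.obj h),
    map (a ≫ b) = map a ≫ map b

namespace Realization

variable {D : PartialIsoDiagram.{u}} {C : Type u} [SmallCategory C]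

/-- A functor from `⟨D⟩`, described on the vertices. -/
def ofFunctor (F : D.PresCat ⥤ C) : Realization D C where
  obj e := F.obj (D.obj e)
  map a := F.map a
  map_id _ := F.map_id _
  map_comp _ _ := F.map_comp _ _

/-- The functor described by a realization. -/
def functor (R : Realization D C) : D.PresCat ⥤ C where
  obj X := R.obj X.as
  map {X Y} a := R.map (e := X.as) (f := Y.as) a
  map_id X := R.map_id X.as
  map_comp {X Y Z} a b := R.map_comp (e := X.as) (f := Y.as) (h := Z.as) a b

variable (R : Realization D C)

theorem isIso_map {e f : D.V} {a : D.obj e ⟶ D.obj f} (ha : IsIso a) : IsIso (R.map a) :=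
  ⟨R.map (inv a), by rw [← R.map_comp, IsIso.hom_inv_id, R.map_id],
    by rw [← R.map_comp, IsIso.inv_hom_id, R.map_id]⟩

instance {e : D.V} (g : D.grp e) : IsIso (R.map (D.loop g)) := R.isIso_map inferInstance

/-- A realization of `D` in a skeletal Rees category that identifies the vertices with the
objects, the vertex groups with the local groups, and the edges with representatives of the
`J`-classes of atoms. -/
structure IsTransversal : Prop where
  bijective_obj : Function.Bijective R.obj
  loop_surjective : ∀ {e : D.V} (a : R.obj e ⟶ R.obj e), IsIso a → ∃ g, R.map (D.loop g) = a
  loop_injective : ∀ {e : D.V} (g h : D.grp e), R.map (D.loop g) = R.map (D.loop h) → g = h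
  isAtom : ∀ {e f : D.V} (x : D.Edge e f), IsAtomArrow (R.map (D.edge x))
  exists_edge : ∀ {e f : D.V} (a : R.obj e ⟶ R.obj f), IsAtomArrow a →
    ∃ x : D.Edge e f, GreenJ a (R.map (D.edge x))
  edge_injective : ∀ {e f : D.V} (x y : D.Edge e f),
    GreenJ (R.map (D.edge x)) (R.map (D.edge y)) → x = y
  maps : ∀ {e f : D.V} (x : D.Edge e f) (g : D.grp e) (h : D.grp f),
    R.map (D.loop g) ≫ R.map (D.edge x) = R.map (D.edge x) ≫ R.map (D.loop h) → D.Maps x g h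

namespace IsTransversal

variable {R} (hR : R.IsTransversal) (hC : IsReesCategory C) (hs : Skeletal C)
include hR hC

theorem not_isIso_map_step {e f h : D.V} (g : D.grp e) (x : D.Edge e f)
    (a : D.obj f ⟶ D.obj h) : ¬ IsIso (R.map (D.loop g ≫ D.edge x ≫ a)) := by
  rw [R.map_comp, R.map_comp]
  intro h
  have := (hC.isIso_of_isIso_comp (R.map (D.loop g)) (R.map (D.edge x) ≫ R.map a)).2
  exact (hR.isAtom x).1 (hC.isIso_of_isIso_comp _ (R.map a)).1

include hs

/-- If two images agree, their first atoms differ by an invertible arrow, which by skeletality is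
the image of a loop. Then `edge_injective` identifies the edges, and cancellation in C reduces to
the tails. -/
theorem map_injective {e f : D.V} (a b : D.obj e ⟶ D.obj f) (w : R.map a = R.map b) :
    a = b := by
  induction a using hom_induction with
  | loop g =>
    by_cases hb : length b = 0
    · obtain ⟨h, rfl⟩ := exists_loop_of_length_eq_zero hb
      rw [hR.loop_injective _ _ w]
    · obtain ⟨f', h, y, b, rfl⟩ := exists_step_of_length_ne_zero hb
      exact absurd (w ▸ R.isIso_map inferInstance) (hR.not_isIso_map_step hC h y b)
  | @step e f f₁ g x a ih =>
    by_cases hb : length b = 0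
    · exact absurd (w ▸ R.isIso_map ((isIso_iff_length_eq_zero b).2 hb))
        (hR.not_isIso_map_step hC g x a)
    obtain ⟨f', h, y, b, rfl⟩ := exists_step_of_length_ne_zero hb
    have hat : ∀ {f : D.V} (x : D.Edge e f) (g : D.grp e),
        IsAtomArrow (R.map (D.loop g) ≫ R.map (D.edge x)) := by
      intro f x g
      simpa using (hR.isAtom x).conj (R.map (D.loop g)) (𝟙 _)
    have w₀ := w
    simp only [R.map_comp] at w
    rw [← Category.assoc, ← Category.assoc] at w
    obtain ⟨k, hk, hk'⟩ := hC.exists_isIso_of_atom_comp_eq (hat x g) (hat y h) w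
    obtain rfl : f' = f := hR.bijective_obj.1 (hs ⟨asIso k⟩)
    obtain ⟨m, rfl⟩ := hR.loop_surjective k hk
    have hx : R.map (D.edge x) =
        R.map (D.loop (g⁻¹ * h)) ≫ R.map (D.edge y) ≫ R.map (D.loop m) := by
      rw [loop_mul, R.map_comp, Category.assoc, ← Category.assoc (R.map (D.loop h)), ← hk',
        ← Category.assoc, ← R.map_comp, loop_inv_mul, R.map_id, Category.id_comp]
    obtain rfl : x = y := hR.edge_injective x y (by rw [hx]; exact greenJ_conj _ _ _)
    -- The comparison of first atoms in C is a relation (h⁻¹g)x = xm; by `maps` it is one of the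
    -- defining relations of `⟨D⟩`.
    have hm : D.Maps x (h⁻¹ * g) m := by
      refine hR.maps x _ _ ?_
      rw [loop_mul, R.map_comp, Category.assoc, hk', Category.assoc, ← Category.assoc,
        ← R.map_comp, loop_inv_mul, R.map_id, Category.id_comp]
    rw [maps_iff, loop_mul, Category.assoc] at hm
    have hgx : D.loop g ≫ D.edge x = D.loop h ≫ D.edge x ≫ D.loop m := by
      rw [← hm, ← Category.assoc, loop_mul_inv, Category.id_comp]
    have hgx' : D.loop g ≫ D.edge x ≫ a = D.loop h ≫ D.edge x ≫ D.loop m ≫ a := by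
      rw [← Category.assoc, hgx]
      simp only [Category.assoc]
    rw [hgx'] at w₀ ⊢
    simp only [R.map_comp] at w₀
    have w₁ := hC.leftCancellative _ _ _ _ _ _ (hC.leftCancellative _ _ _ _ _ _ w₀)
    have := ih (D.loop m⁻¹ ≫ b) (by
      rw [R.map_comp, ← w₁, ← R.map_comp, ← R.map_comp, loop_inv_mul_assoc])
    rw [this, loop_mul_inv_assoc]

/-- Each arrow is a product of invertible arrows, which are images of loops, and atoms, which are
images of edges up to invertible factors. -/
theorem map_surjective {e f : D.V} (a : R.obj e ⟶ R.obj f) : ∃ b, R.map b = a := by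
  -- The ends of the arrow are kept as arbitrary objects, related to vertices by equations, because
  -- the induction passes through intermediate objects of C.
  have key : ∀ {X Y : C} (a : X ⟶ Y) (e f : D.V) (_ : R.obj e = X) (_ : R.obj f = Y),
      ∃ b : D.obj e ⟶ D.obj f, HEq (R.map b) a := by
    intro X Y a
    induction a using hC.arrow_induction with
    | iso a ha =>
      rintro e f rfl rfl
      obtain rfl : e = f := hR.bijective_obj.1 (hs ⟨asIso a⟩)
      obtain ⟨g, hg⟩ := hR.loop_surjective a ha
      exact ⟨_, heq_of_eq hg⟩
    | atom a ha =>
      rintro e f rfl rfl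
      obtain ⟨x, hx⟩ := hR.exists_edge a ha
      obtain ⟨⟨p, q, h⟩, -⟩ := hx
      obtain ⟨hp, hq⟩ := hC.isIso_of_atom_eq ha (hR.isAtom x).1 h
      obtain ⟨g, rfl⟩ := hR.loop_surjective p hp
      obtain ⟨k, rfl⟩ := hR.loop_surjective q hq
      exact ⟨D.loop g ≫ D.edge x ≫ D.loop k, by rw [h, R.map_comp, R.map_comp]⟩
    | @comp X Y Z a b iha ihb =>
      rintro e f rfl rfl
      obtain ⟨h, rfl⟩ := hR.bijective_obj.2 Y
      obtain ⟨a', ha⟩ := iha e h rfl rfl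
      obtain ⟨b', hb⟩ := ihb h f rfl rfl
      exact ⟨a' ≫ b', by rw [R.map_comp, eq_of_heq ha, eq_of_heq hb]⟩
  obtain ⟨b, hb⟩ := key a e f rfl rfl
  exact ⟨b, eq_of_heq hb⟩

theorem catIsomorphic : CatIsomorphic D.PresCat C := by
  refine ⟨R.functor, ⟨fun X Y h => ?_, fun Z => ?_⟩, fun X Y => ⟨fun a b h => ?_, fun a => ?_⟩⟩
  · have := congrArg D.obj (hR.bijective_obj.1 h)
    exact this
  · obtain ⟨e, rfl⟩ := hR.bijective_obj.2 Z
    exact ⟨D.obj e, rfl⟩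
  · exact hR.map_injective hC hs (e := X.as) (f := Y.as) a b h
  · exact hR.map_surjective hC hs (e := X.as) (f := Y.as) a

end IsTransversal

section Generators

variable (o : D.V → C)
    (l : ∀ e, D.grp e → (o e ⟶ o e)) (x : ∀ {e f : D.V}, D.Edge e f → (o e ⟶ o f))
    (one : ∀ e, l e 1 = 𝟙 (o e)) (mul : ∀ e (g h : D.grp e), l e g ≫ l e h = l e (g * h))
    (comm : ∀ {e f : D.V} (y : D.Edge e f) (g : D.dom y), l e g ≫ x y = x y ≫ l f (D.φ y g))

/-- The realization with given values on the generators. -/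
def ofGenerators : Realization D C :=
  ofFunctor (lift o l x one mul comm)

theorem ofGenerators_loop {e : D.V} (g : D.grp e) :
    (ofGenerators o l x one mul comm).map (D.loop g) = l e g :=
  lift_loop o l x one mul comm g

theorem ofGenerators_edge {e f : D.V} (y : D.Edge e f) :
    (ofGenerators o l x one mul comm).map (D.edge y) = x y :=
  lift_edge o l x one mul comm y

end Generators

end Realization

end PartialIsoDiagram

/-! ### The diagram of a category -/

namespace AtomicTransversal

variable {C : Type u} [SmallCategory C]

theorem maps_diagram_iff (T : AtomicTransversal C) (hC : IsReesCategory C) {e f : C}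
    (x : T.carrier e f) (g : LocalGroup e) (h : LocalGroup f) :
    (T.diagram hC).Maps (e := e) (f := f) x g h ↔ g.arrow ≫ x.1 = x.1 ≫ h.arrow := by
  constructor
  · rintro ⟨hg, rfl⟩
    exact atomFun_spec x.1 ⟨g, hg⟩
  · intro w
    refine ⟨⟨h, w⟩, LocalGroup.arrow_injective (hC.leftCancellative _ _ _ x.1 _ _ ?_)⟩
    rw [← w]
    exact (atomFun_spec x.1 ⟨g, h, w⟩).symm

/-- The tautological realization of the diagram of `C` in `C`. -/
noncomputable def realization (T : AtomicTransversal C) (hC : IsReesCategory C) :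
    (T.diagram hC).Realization C :=
  .ofGenerators (D := T.diagram hC) (C := C) (fun e => e) (fun _ g => LocalGroup.arrow g)
    (fun x => x.1) (fun _ => rfl) (fun _ _ _ => rfl) (fun x g => atomFun_spec x.1 g)

theorem realization_loop (T : AtomicTransversal C) (hC : IsReesCategory C) {e : C}
    (g : LocalGroup e) :
    (T.realization hC).map ((T.diagram hC).loop (e := e) g) = g.arrow :=
  PartialIsoDiagram.Realization.ofGenerators_loop (D := T.diagram hC) (C := C) _ _ _ _ _
    (fun x g => atomFun_spec x.1 g) g

theorem realization_edge (T : AtomicTransversal C) (hC : IsReesCategory C) {e f : C}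
    (x : T.carrier e f) :
    (T.realization hC).map ((T.diagram hC).edge (e := e) (f := f) x) = x.1 :=
  PartialIsoDiagram.Realization.ofGenerators_edge (D := T.diagram hC) (C := C) _ _ _ _ _
    (fun x g => atomFun_spec x.1 g) x

/-- Vertex groups, edges and partial isomorphisms of the diagram are taken from C itself, so the
criterion applies and gives `⟨D(C,T)⟩ ≅ C`. -/
theorem isTransversal_realization (T : AtomicTransversal C) (hC : IsReesCategory C) :
    (T.realization hC).IsTransversal where
  bijective_obj := Function.bijective_id
  loop_surjective {e} a ha := ⟨@asIso C _ _ _ a ha, T.realization_loop hC (@asIso C _ _ _ a ha)⟩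
  loop_injective {e} g h w := by
    exact LocalGroup.arrow_injective
      ((T.realization_loop hC g).symm.trans (w.trans (T.realization_loop hC h)))
  isAtom {e f} x := (T.realization_edge hC x).symm ▸ T.isAtom e f x.1 x.2
  exists_edge {e f} a ha := by
    obtain ⟨x, ⟨hx, h⟩, -⟩ := T.existsUnique e f a ha
    exact ⟨(⟨x, hx⟩ : T.carrier e f), (T.realization_edge hC ⟨x, hx⟩).symm ▸ h⟩
  edge_injective {e f} x y h := by
    have hx := T.realization_edge hC x
    have hy := T.realization_edge hC y
    rw [hx, hy] at h
    exact Subtype.ext ((T.existsUnique e f x.1 (T.isAtom e f x.1 x.2)).unique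
      ⟨x.2, .refl _⟩ ⟨y.2, h⟩)
  maps {e f} x g h w := by
    refine (T.maps_diagram_iff hC x g h).2 ?_
    have hg := T.realization_loop hC g
    have hh := T.realization_loop hC h
    have hx := T.realization_edge hC x
    rw [hg, hh, hx] at w
    exact w

theorem isSerre_diagram (T : AtomicTransversal C) (hC : IsSerreCategory C) :
    (T.diagram hC.toIsReesCategory).IsSerre where
  finite_vertices := hC.finite_obj
  nonempty_vertices := hC.nonempty_obj
  finite_edges e f := by
    have := hC.finite_atoms e f
    refine Finite.of_injective (β := Quotient (atomSetoid (C := C) e f))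
      (fun x : T.carrier e f => Quotient.mk _ ⟨x.1, T.isAtom e f x.1 x.2⟩) fun x y h => ?_
    exact Subtype.ext ((T.existsUnique e f x.1 (T.isAtom e f x.1 x.2)).unique
      ⟨x.2, .refl _⟩ ⟨y.2, Quotient.exact h⟩)
  connected := by
    -- An arrow is a product of atoms, each J-related to a member of T in its own hom-set, and of
    -- invertible arrows, which by skeletality do not change the object.
    have key : ∀ {e f : C}, (e ⟶ f) →
        Relation.EqvGen (fun a b : C => Nonempty (T.carrier a b)) e f := by
      intro e f a
      induction a using hC.toIsReesCategory.arrow_induction with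
      | iso a ha =>
        obtain rfl := hC.skeletal ⟨asIso a⟩
        exact .refl _
      | @atom e f a ha =>
        obtain ⟨x, ⟨hx, -⟩, -⟩ := T.existsUnique e f a ha
        exact .rel _ _ ⟨⟨x, hx⟩⟩
      | comp _ _ h1 h2 => exact .trans _ _ _ h1 h2
    intro e f
    induction (hC.connected e f) with
    | refl => exact .refl _
    | tail _ h ih =>
      rcases h with ⟨⟨a⟩⟩ | ⟨⟨a⟩⟩
      · exact .trans _ _ _ ih (key a)
      · exact .trans _ _ _ ih (.symm _ _ (key a))

end AtomicTransversal

theorem nonempty_atomicTransversal (C : Type u) [SmallCategory C] :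
    Nonempty (AtomicTransversal C) := by
  refine ⟨{
    carrier := fun e f => Set.range fun q : Quotient (atomSetoid e f) => q.out.1
    isAtom := ?_
    existsUnique := ?_ }⟩
  · rintro e f _ ⟨q, rfl⟩
    exact q.out.2
  · intro e f a ha
    have h : GreenJ a (Quotient.mk (atomSetoid e f) ⟨a, ha⟩).out.1 :=
      (Quotient.mk_out (s := atomSetoid e f) ⟨a, ha⟩).symm
    refine ⟨_, ⟨⟨_, rfl⟩, h⟩, ?_⟩
    rintro _ ⟨⟨q, rfl⟩, h'⟩
    have : q = Quotient.mk (atomSetoid e f) ⟨a, ha⟩ := by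
      rw [← Quotient.out_eq q]
      exact Quotient.sound h'.symm
    rw [this]

/-! ### Recovering D from `⟨D⟩`, and conjugacies as functors -/

namespace PartialIsoDiagram

variable {D D' : PartialIsoDiagram.{u}}

/-- The loop of `g` as an element of the local group. -/
def loopAut (D : PartialIsoDiagram.{u}) {e : D.V} (g : D.grp e) : LocalGroup (D.obj e) :=
  D.loopIso g

theorem arrow_loopAut {e : D.V} (g : D.grp e) : (D.loopAut g).arrow = D.loop g := rfl

/-- The vertex groups of `D` are the local groups of `⟨D⟩`. -/
noncomputable def localGroupEquiv (D : PartialIsoDiagram.{u}) (e : D.V) :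
    D.grp e ≃* LocalGroup (D.obj e) :=
  MulEquiv.ofBijective
    (MonoidHom.mk' D.loopAut fun g h => LocalGroup.arrow_injective (by
      rw [LocalGroup.arrow_mul, arrow_loopAut, arrow_loopAut, arrow_loopAut, loop_mul]))
    ⟨fun g h w => loop_injective (congrArg LocalGroup.arrow w), fun a => by
      obtain ⟨g, hg⟩ := exists_loop_of_length_eq_zero (a := a.arrow)
        ((isIso_iff_length_eq_zero _).1 (Iso.isIso_hom a))
      exact ⟨g, LocalGroup.arrow_injective hg.symm⟩⟩

theorem arrow_localGroupEquiv {e : D.V} (g : D.grp e) :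
    (D.localGroupEquiv e g).arrow = D.loop g := rfl

theorem loop_localGroupEquiv_symm {e : D.V} (a : LocalGroup (D.obj e)) :
    D.loop ((D.localGroupEquiv e).symm a) = a.arrow := by
  rw [← arrow_localGroupEquiv, MulEquiv.apply_symm_apply]

/-- The edges of `D` form an atomic transversal of `⟨D⟩`. -/
def edgeTransversal (D : PartialIsoDiagram.{u}) : AtomicTransversal D.PresCat where
  carrier X Y := Set.range fun x : D.Edge (vertex X) (vertex Y) => D.edge x
  isAtom := by
    rintro X Y _ ⟨x, rfl⟩
    exact isAtomArrow_edge x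
  existsUnique := by
    intro X Y a ha
    obtain ⟨x, hx, h⟩ := D.existsUnique_edge_of_isAtomArrow (e := vertex X) (f := vertex Y) a ha
    refine ⟨D.edge x, ⟨⟨x, rfl⟩, hx⟩, ?_⟩
    rintro _ ⟨⟨y, rfl⟩, hy⟩
    exact congrArg D.edge (h y hy)

theorem edge_injective {e f : D.V} {x y : D.Edge e f} (w : D.edge x = D.edge y) : x = y :=
  edge_injective_of_conj (g := 1) (g' := 1) (h := 1) (h' := 1) (by rw [w])

/-- The diagram of `⟨D⟩` relative to the transversal of the edges of `D` is `D`. -/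
noncomputable def edgeTransversalIso (D : PartialIsoDiagram.{u}) (hC : IsReesCategory D.PresCat) :
    (D.edgeTransversal.diagram hC).Iso D where
  vert := ⟨vertex, D.obj, fun _ => rfl, fun _ => rfl⟩
  edge {X Y} := (Equiv.ofInjective (fun x : D.Edge (vertex X) (vertex Y) => D.edge x)
    fun _ _ h => edge_injective h).symm
  grp X := (D.localGroupEquiv (vertex X)).symm
  maps_iff := by
    intro (X : D.PresCat) (Y : D.PresCat) (x : D.edgeTransversal.carrier X Y)
      (g : LocalGroup X) (h : LocalGroup Y)
    refine (D.edgeTransversal.maps_diagram_iff hC x g h).trans ?_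
    obtain ⟨e, rfl⟩ := obj_surjective X
    obtain ⟨f, rfl⟩ := obj_surjective Y
    obtain ⟨_, x, rfl⟩ := x
    have hx : (Equiv.ofInjective (fun x : D.Edge e f => D.edge x)
        fun _ _ h => edge_injective h).symm ⟨D.edge x, x, rfl⟩ = x :=
      Equiv.ofInjective_symm_apply (f := fun x : D.Edge e f => D.edge x) _ x
    change _ ↔ D.Maps ((Equiv.ofInjective (fun x : D.Edge e f => D.edge x)
        fun _ _ h => edge_injective h).symm ⟨D.edge x, x, rfl⟩)
        ((D.localGroupEquiv e).symm g) ((D.localGroupEquiv f).symm h)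
    rw [hx]
    have key := maps_iff (D := D) (e := e) (f := f) x ((D.localGroupEquiv e).symm g)
      ((D.localGroupEquiv f).symm h)
    rw [loop_localGroupEquiv_symm, loop_localGroupEquiv_symm] at key
    exact key.symm

theorem loop_conj {e : D.V} (a g : D.grp e) :
    D.loop (MulAut.conj a g) = D.loop a ≫ D.loop g ≫ D.loop a⁻¹ := by
  rw [MulAut.conj_apply, loop_mul, loop_mul, Category.assoc]

/-- Conjugating the partial isomorphism at x amounts to replacing the arrow x by a⁻¹xb. -/
theorem maps_conj_iff {e f : D.V} (x : D.Edge e f) (a g : D.grp e) (b h : D.grp f) :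
    D.Maps x (MulAut.conj a g) (MulAut.conj b h) ↔
      D.loop g ≫ D.loop a⁻¹ ≫ D.edge x ≫ D.loop b =
        (D.loop a⁻¹ ≫ D.edge x ≫ D.loop b) ≫ D.loop h := by
  rw [maps_iff, loop_conj, loop_conj]
  constructor
  · intro w
    have := congrArg (fun p => D.loop a⁻¹ ≫ p ≫ D.loop b) w
    simpa only [Category.assoc, loop_inv_mul_assoc, loop_inv_mul, Category.comp_id] using this
  · intro w
    have := congrArg (fun p => D.loop a ≫ p ≫ D.loop b⁻¹) w
    simpa only [Category.assoc, loop_mul_inv_assoc, loop_mul_inv, Category.comp_id] using this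

namespace ConjIso

variable (i : D.ConjIso D')

theorem maps_comm {e f : D.V} (x : D.Edge e f) (g : D.dom x) :
    D'.loop (i.grp e g) ≫ D'.loop (i.conj x).choose⁻¹ ≫ D'.edge (i.edge x) ≫
      D'.loop (i.conj x).choose_spec.choose =
    (D'.loop (i.conj x).choose⁻¹ ≫ D'.edge (i.edge x) ≫
      D'.loop (i.conj x).choose_spec.choose) ≫ D'.loop (i.grp f (D.φ x g)) :=
  (maps_conj_iff _ _ _ _ _).1 (((i.conj x).choose_spec.choose_spec _ _).1 ⟨g.2, rfl⟩)

/-- The functor from `⟨D⟩` to `⟨D'⟩` given by a conjugacy from `D` to `D'`. -/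
noncomputable def realization : D.Realization D'.PresCat :=
  .ofGenerators (fun e => D'.obj (i.vert e)) (fun e g => D'.loop (i.grp e g))
    (fun x => D'.loop (i.conj x).choose⁻¹ ≫ D'.edge (i.edge x) ≫
      D'.loop (i.conj x).choose_spec.choose)
    (fun e => by rw [map_one, loop_one]) (fun e g h => by rw [map_mul, loop_mul])
    i.maps_comm

theorem realization_loop {e : D.V} (g : D.grp e) :
    i.realization.map (D.loop g) = D'.loop (i.grp e g) :=
  Realization.ofGenerators_loop _ _ _ _ _ i.maps_comm g

/-- Hides the choices behind `realization`: one pair a, b serves both for the image of x and for the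
conjugacy condition. -/
theorem exists_realization_edge {e f : D.V} (x : D.Edge e f) :
    ∃ (a : D'.grp (i.vert e)) (b : D'.grp (i.vert f)),
      i.realization.map (D.edge x) = D'.loop a⁻¹ ≫ D'.edge (i.edge x) ≫ D'.loop b ∧
      ∀ (g : D.grp e) (h : D.grp f),
        D.Maps x g h ↔
          D'.Maps (i.edge x) (MulAut.conj a (i.grp e g)) (MulAut.conj b (i.grp f h)) :=
  ⟨_, _, Realization.ofGenerators_edge _ _ _ _ _ i.maps_comm x, (i.conj x).choose_spec.choose_spec⟩

theorem greenJ_realization_edge {e f : D.V} (x : D.Edge e f) :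
    GreenJ (i.realization.map (D.edge x)) (D'.edge (i.edge x)) := by
  obtain ⟨a, b, h, -⟩ := i.exists_realization_edge x
  rw [h]
  exact greenJ_conj (D'.edge (i.edge x)) (D'.loop a⁻¹) (D'.loop b)

/-- The image a⁻¹x'b of x is J-related to the matching edge x', and the conjugacy condition says
that it satisfies the same relations with loops as x. -/
theorem isTransversal_realization : i.realization.IsTransversal where
  bijective_obj := ⟨fun e f h => i.vert.injective (obj_injective h), fun X =>
    ⟨i.vert.symm (vertex X), congrArg D'.obj (i.vert.apply_symm_apply (vertex X))⟩⟩
  loop_surjective {e} a ha := by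
    obtain ⟨g, hg⟩ := exists_loop_of_length_eq_zero (D := D') (e := i.vert e)
      ((isIso_iff_length_eq_zero a).1 ha)
    refine ⟨(i.grp e).symm g, ?_⟩
    rw [realization_loop, MulEquiv.apply_symm_apply]
    exact hg.symm
  loop_injective {e} g h w := by
    rw [realization_loop, realization_loop] at w
    exact (i.grp e).injective (PartialIsoDiagram.loop_injective w)
  isAtom x := by
    obtain ⟨a, b, h, -⟩ := i.exists_realization_edge x
    rw [h]
    exact (isAtomArrow_edge (i.edge x)).conj (D'.loop a⁻¹) (D'.loop b)
  exists_edge {e f} a ha := by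
    obtain ⟨y, hy, -⟩ := D'.existsUnique_edge_of_isAtomArrow (e := i.vert e) (f := i.vert f) a ha
    refine ⟨i.edge.symm y, GreenJ.trans hy ?_⟩
    have := i.greenJ_realization_edge (i.edge.symm y)
    rw [Equiv.apply_symm_apply] at this
    exact this.symm
  edge_injective {e f} x y h := by
    have h' := ((i.greenJ_realization_edge x).symm.trans h).trans (i.greenJ_realization_edge y)
    exact i.edge.injective ((D'.existsUnique_edge_of_isAtomArrow _
      (isAtomArrow_edge (i.edge x))).unique (.refl _) h')
  maps {e f} x g h w := by
    obtain ⟨a, b, hx, hab⟩ := i.exists_realization_edge x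
    rw [realization_loop, realization_loop, hx] at w
    exact (hab g h).2 ((maps_conj_iff _ _ _ _ _).2 w)

include i in
theorem catIsomorphic : CatIsomorphic D.PresCat D'.PresCat :=
  i.isTransversal_realization.catIsomorphic D'.isReesCategory_presCat D'.skeletal_presCat

end ConjIso

/-! ### From an isomorphism of categories to a conjugacy -/

section

variable (v : D.V ≃ D'.V)
  (M : ∀ {e f : D.V}, (D.obj e ⟶ D.obj f) → (D'.obj (v e) ⟶ D'.obj (v f)))
  (bij : ∀ e f : D.V, Function.Bijective (M (e := e) (f := f)))
  (map_id : ∀ e, M (𝟙 (D.obj e)) = 𝟙 _)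
  (map_comp : ∀ {e f h : D.V} (a : D.obj e ⟶ D.obj f) (b : D.obj f ⟶ D.obj h),
    M (a ≫ b) = M a ≫ M b)
include bij map_comp

theorem memPrincipalIdeal_map_iff {e f e' f' : D.V} (a : D.obj e ⟶ D.obj f)
    (b : D.obj e' ⟶ D.obj f') :
    MemPrincipalIdeal (M a) (M b) ↔ MemPrincipalIdeal a b := by
  constructor
  · rintro ⟨p, q, h⟩
    obtain ⟨p, rfl⟩ := (bij _ _).2 p
    obtain ⟨q, rfl⟩ := (bij _ _).2 q
    rw [← map_comp, ← map_comp] at h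
    exact ⟨p, q, (bij _ _).1 h⟩
  · rintro ⟨p, q, h⟩
    exact ⟨M p, M q, by rw [h, map_comp, map_comp]⟩

theorem greenJ_map_iff {e f e' f' : D.V} (a : D.obj e ⟶ D.obj f) (b : D.obj e' ⟶ D.obj f') :
    GreenJ (M a) (M b) ↔ GreenJ a b :=
  and_congr (memPrincipalIdeal_map_iff v M bij map_comp a b)
    (memPrincipalIdeal_map_iff v M bij map_comp b a)

include map_id

theorem isIso_map_iff {e f : D.V} (a : D.obj e ⟶ D.obj f) : IsIso (M a) ↔ IsIso a := by
  constructor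
  · intro _
    obtain ⟨b, hb⟩ := (bij _ _).2 (inv (M a))
    refine ⟨b, (bij _ _).1 ?_, (bij _ _).1 ?_⟩
    · rw [map_comp, hb, IsIso.hom_inv_id, map_id]
    · rw [map_comp, hb, IsIso.inv_hom_id, map_id]
  · intro _
    exact ⟨M (inv a), by rw [← map_comp, IsIso.hom_inv_id, map_id],
      by rw [← map_comp, IsIso.inv_hom_id, map_id]⟩

theorem isAtomArrow_map_iff {e f : D.V} (a : D.obj e ⟶ D.obj f) :
    IsAtomArrow (M a) ↔ IsAtomArrow a := by
  have iso := @isIso_map_iff D D' v M bij map_id map_comp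
  refine and_congr (not_congr (iso a)) ⟨fun h Z b c w => ?_, fun h Z b c w => ?_⟩
  · obtain ⟨k, rfl⟩ := obj_surjective Z
    rw [← iso, ← iso c]
    exact h _ (M b) (M c) (by rw [w, map_comp])
  · obtain ⟨k, rfl⟩ := obj_surjective Z
    obtain ⟨k, rfl⟩ := v.surjective k
    obtain ⟨b, rfl⟩ := (bij _ _).2 b
    obtain ⟨c, rfl⟩ := (bij _ _).2 c
    rw [iso, iso]
    exact h _ b c ((bij _ _).1 (by rw [w, map_comp]))

/-- The isomorphism of vertex groups given by an isomorphism of categories. -/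
theorem exists_grp_equiv (e : D.V) :
    ∃ θ : D.grp e ≃* D'.grp (v e), ∀ g, D'.loop (θ g) = M (D.loop g) := by
  have iso := @isIso_map_iff D D' v M bij map_id map_comp
  have h1 : ∀ g : D.grp e, ∃ h, M (D.loop g) = D'.loop h := fun g =>
    exists_loop_of_length_eq_zero ((isIso_iff_length_eq_zero _).1 ((iso _).2 inferInstance))
  choose θ hθ using h1
  refine ⟨MulEquiv.ofBijective (MonoidHom.mk' θ fun g h => loop_injective ?_)
    ⟨fun g h w => ?_, fun k => ?_⟩, fun g => (hθ g).symm⟩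
  · rw [loop_mul, ← hθ, ← hθ, ← hθ, loop_mul, map_comp]
  · change θ g = θ h at w
    refine loop_injective ((bij _ _).1 ?_)
    rw [hθ, hθ, w]
  · obtain ⟨a, ha⟩ := (bij _ _).2 (D'.loop k)
    obtain ⟨g, rfl⟩ := exists_loop_of_length_eq_zero (a := a)
      ((isIso_iff_length_eq_zero _).1 ((iso _).1 (ha ▸ inferInstance)))
    exact ⟨g, loop_injective (by rw [← ha, hθ]; rfl)⟩

/-- The bijection between edges given by an isomorphism of categories. -/
theorem exists_edge_equiv (e f : D.V) :
    ∃ ε : D.Edge e f ≃ D'.Edge (v e) (v f), ∀ x, GreenJ (M (D.edge x)) (D'.edge (ε x)) := by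
  have atom := @isAtomArrow_map_iff D D' v M bij map_id map_comp
  have green := @greenJ_map_iff D D' v M bij map_comp
  have h1 : ∀ x : D.Edge e f, ∃ y, GreenJ (M (D.edge x)) (D'.edge y) := fun x =>
    (D'.existsUnique_edge_of_isAtomArrow _ ((atom _).2 (isAtomArrow_edge x))).exists
  choose ε hε using h1
  refine ⟨Equiv.ofBijective ε ⟨fun x y h => ?_, fun y => ?_⟩, hε⟩
  · have := (hε x).trans (h ▸ (hε y).symm)
    rw [green] at this
    exact (D.existsUnique_edge_of_isAtomArrow _ (isAtomArrow_edge x)).unique (.refl _) this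
  · obtain ⟨a, ha⟩ := (bij _ _).2 (D'.edge y)
    have haa : IsAtomArrow a := (atom a).1 (ha ▸ isAtomArrow_edge y)
    obtain ⟨x, hx, -⟩ := D.existsUnique_edge_of_isAtomArrow a haa
    refine ⟨x, ((D'.existsUnique_edge_of_isAtomArrow _ (isAtomArrow_edge y)).unique
      (.refl _) ?_).symm⟩
    rw [← green, ha] at hx
    exact hx.trans (hε x)

/-- The image of x is an atom J-related to the matching edge x', hence equal to ax'b with a, b
loops; these are the conjugating elements. -/
theorem nonempty_conjIso : Nonempty (D.ConjIso D') := by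
  choose θ hθ using exists_grp_equiv v M bij map_id map_comp
  choose ε hε using exists_edge_equiv v M bij map_id map_comp
  refine ⟨⟨v, fun {e f} => ε e f, θ, fun {e f} x => ?_⟩⟩
  have atom := @isAtomArrow_map_iff D D' v M bij map_id map_comp
  obtain ⟨⟨p, q, h⟩, -⟩ := hε e f x
  obtain ⟨h1, h2⟩ := D'.isReesCategory_presCat.isIso_of_atom_eq ((atom _).2 (isAtomArrow_edge x))
    (isAtomArrow_edge _).1 h
  rw [isIso_iff_length_eq_zero] at h1 h2
  obtain ⟨a, rfl⟩ := exists_loop_of_length_eq_zero h1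
  obtain ⟨b, rfl⟩ := exists_loop_of_length_eq_zero h2
  -- The inverse appears because `maps_conj_iff` attaches a⁻¹xb, not axb, to the pair (a, b).
  refine ⟨a⁻¹, b, fun g k => ?_⟩
  rw [maps_conj_iff, inv_inv, ← h, hθ, hθ, ← map_comp, ← map_comp, maps_iff]
  exact (bij _ _).1.eq_iff.symm

end

theorem nonempty_conjIso_of_catIsomorphic (h : CatIsomorphic D.PresCat D'.PresCat) :
    Nonempty (D.ConjIso D') := by
  obtain ⟨F, hobj, hF⟩ := h
  let v : D.V ≃ D'.V := Equiv.ofBijective (fun e => vertex (F.obj (D.obj e)))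
    ⟨fun e f h => obj_injective (hobj.1 (congrArg D'.obj h)), fun e => by
      obtain ⟨X, hX⟩ := hobj.2 (D'.obj e)
      exact ⟨vertex X, congrArg vertex hX⟩⟩
  exact nonempty_conjIso v (fun {e f} a => F.map a) (fun e f => hF (D.obj e) (D.obj f))
    (fun e => F.map_id _) (fun a b => F.map_comp a b)

end PartialIsoDiagram

/-! ### Edge groups and reversal -/

namespace GraphOfGroups

variable (G : GraphOfGroups.{u})

theorem ecast_heq {q r : G.GeomEdge} (h : q = r) (c : G.egrp q) : HEq (G.ecast h c) c := by
  subst h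
  rfl

theorem ι_ecast {P Q : G.V} {y z : G.E P Q} (w : y = z) (h : G.geom y = G.geom z)
    (c : G.egrp (G.geom y)) : G.ι z (G.ecast h c) = G.ι y c := by
  subst w
  rw [eq_of_heq (G.ecast_heq h c)]

theorem ecast_ecast {q r s : G.GeomEdge} (h : q = r) (k : r = s) (c : G.egrp q) :
    G.ecast k (G.ecast h c) = G.ecast (h.trans k) c := by
  subst h
  subst k
  rfl

theorem ι_bar_ecast {P Q : G.V} (y : G.E P Q) (c : G.egrp (G.geom y)) :
    G.ι (G.bar y) (G.ecast (G.geom_bar y) c) = G.ιo y c := rfl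

/-- With `ι_bar_ecast`: reversal exchanges the two monomorphisms of an edge, up to transport of the
edge group. -/
theorem ιo_bar_ecast {P Q : G.V} (y : G.E P Q) (c : G.egrp (G.geom y)) :
    G.ιo (G.bar y) (G.ecast (G.geom_bar y) c) = G.ι y c := by
  change G.ι (G.bar (G.bar y)) (G.ecast _ (G.ecast _ c)) = _
  rw [ecast_ecast, G.ι_ecast (G.bar_bar y).symm]

end GraphOfGroups

/-! ### Oriented graphs of groups and their diagrams -/

namespace OrientedGraphOfGroups

/-- The graph of the partial isomorphism is a copy of the edge group, embedded by the pair of its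
monomorphisms. So the diagram loses no information about positive edges. -/
theorem maps_diagram_iff (G : OrientedGraphOfGroups.{u}) {P Q : G.V}
    (y : {y : G.E P Q // G.pos y}) (g : G.vgrp P) (h : G.vgrp Q) :
    G.diagram.Maps (e := P) (f := Q) y g h ↔ ∃ c, G.ιo y.1 c = g ∧ G.ι y.1 c = h := by
  have key : ∀ c, (G.diagram.φ (e := P) (f := Q) y ⟨G.ιo y.1 c, c, rfl⟩).1 = G.ι y.1 c := by
    intro c
    have : (MonoidHom.ofInjective (G.ιo_injective y.1)).symm ⟨G.ιo y.1 c, c, rfl⟩ = c :=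
      (MulEquiv.symm_apply_eq _).2 rfl
    exact congrArg (G.ι y.1) this
  constructor
  · rintro ⟨⟨c, rfl⟩, rfl⟩
    exact ⟨c, rfl, (key c).symm⟩
  · rintro ⟨c, rfl, rfl⟩
    exact ⟨⟨c, rfl⟩, key c⟩

theorem isSerre_diagram (G : OrientedGraphOfGroups.{u}) : G.diagram.IsSerre where
  finite_vertices := G.finite_vertices
  nonempty_vertices := G.nonempty_vertices
  finite_edges P Q := by
    have := G.finite_edges P Q
    exact inferInstanceAs (Finite {y : G.E P Q // G.pos y})
  connected P Q := by
    induction G.connected P Q with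
    | refl => exact .refl _
    | tail _ h ih =>
      obtain ⟨y⟩ := h
      refine .trans _ _ _ ih ?_
      by_cases hy : G.pos y
      · exact .rel _ _ ⟨⟨y, hy⟩⟩
      · exact .symm _ _ (.rel _ _ ⟨⟨G.bar y, (G.pos_bar y).2 hy⟩⟩)

/-- The isomorphism of diagrams given by an isomorphism of oriented graphs of groups. -/
def Iso.diagram {G G' : OrientedGraphOfGroups.{u}} (i : G.Iso G') :
    G.diagram.Iso G'.diagram where
  vert := i.vert
  edge {P Q} := i.edge.subtypeEquiv fun y => (i.edge_pos y).symm
  grp := i.vgrp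
  maps_iff {P Q} y g h := by
    refine (G.maps_diagram_iff y g h).trans (Iff.trans ?_ (G'.maps_diagram_iff _ _ _).symm)
    constructor
    · rintro ⟨c, rfl, rfl⟩
      exact ⟨i.egrp y.1 c, (i.map_ιo y.1 c).symm, (i.map_ι y.1 c).symm⟩
    · rintro ⟨c, h1, h2⟩
      obtain ⟨c, rfl⟩ := (i.egrp y.1).surjective c
      exact ⟨c, EquivLike.injective (i.vgrp P) ((i.map_ιo y.1 c).trans h1),
        EquivLike.injective (i.vgrp Q) ((i.map_ι y.1 c).trans h2)⟩

section OfDiagramIso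

variable {G G' : OrientedGraphOfGroups.{u}} (v : G.V ≃ G'.V)
  (η : ∀ P Q : G.V, {y : G.E P Q // G.pos y} ≃ {y : G'.E (v P) (v Q) // G'.pos y})

/-- The image of a positive edge. -/
def posEdgeMap {P Q : G.V} (y : G.E P Q) (hy : G.pos y) : G'.E (v P) (v Q) :=
  (η P Q ⟨y, hy⟩).1

theorem pos_posEdgeMap {P Q : G.V} (y : G.E P Q) (hy : G.pos y) : G'.pos (posEdgeMap v η y hy) :=
  (η P Q ⟨y, hy⟩).2

theorem posEdgeMap_injective {P Q : G.V} {y z : G.E P Q} {hy : G.pos y} {hz : G.pos z}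
    (w : posEdgeMap v η y hy = posEdgeMap v η z hz) : y = z :=
  congrArg Subtype.val ((η P Q).injective (Subtype.ext w))

theorem posEdgeMap_surjective {P Q : G.V} (z : G'.E (v P) (v Q)) (hz : G'.pos z) :
    ∃ (y : G.E P Q) (hy : G.pos y), posEdgeMap v η y hy = z := by
  obtain ⟨⟨y, hy⟩, h⟩ := (η P Q).surjective ⟨z, hz⟩
  exact ⟨y, hy, congrArg Subtype.val h⟩

open Classical in
/-- The map on all edges given by an isomorphism of diagrams. -/
noncomputable def edgeMap {P Q : G.V} (y : G.E P Q) : G'.E (v P) (v Q) :=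
  if hy : G.pos y then posEdgeMap v η y hy
  else G'.bar (posEdgeMap v η (G.bar y) ((G.pos_bar y).2 hy))

theorem edgeMap_of_pos {P Q : G.V} (y : G.E P Q) (hy : G.pos y) :
    edgeMap v η y = posEdgeMap v η y hy := dif_pos hy

theorem edgeMap_bar {P Q : G.V} (y : G.E P Q) : edgeMap v η (G.bar y) = G'.bar (edgeMap v η y) := by
  by_cases hy : G.pos y
  · have h : ¬ G.pos (G.bar y) := fun h => (G.pos_bar y).1 h hy
    rw [edgeMap, dif_neg h, edgeMap_of_pos v η y hy]
    simp only [G.bar_bar]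
  · have h : G.pos (G.bar y) := (G.pos_bar y).2 hy
    rw [edgeMap_of_pos v η _ h, edgeMap, dif_neg hy, G'.bar_bar]

theorem pos_edgeMap {P Q : G.V} (y : G.E P Q) : G'.pos (edgeMap v η y) ↔ G.pos y := by
  by_cases hy : G.pos y
  · rw [edgeMap_of_pos v η y hy]
    exact iff_of_true (pos_posEdgeMap v η y hy) hy
  · have h : G.pos (G.bar y) := (G.pos_bar y).2 hy
    have h2 := pos_posEdgeMap v η _ h
    rw [← edgeMap_of_pos, edgeMap_bar, G'.pos_bar] at h2
    exact iff_of_false h2 hy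

theorem edgeMap_bijective (P Q : G.V) :
    Function.Bijective (edgeMap v η : G.E P Q → G'.E (v P) (v Q)) := by
  constructor
  · intro y z w
    have hpos : G.pos y ↔ G.pos z := by rw [← pos_edgeMap v η, w, pos_edgeMap v η]
    by_cases hy : G.pos y
    · rw [edgeMap_of_pos v η y hy, edgeMap_of_pos v η z (hpos.1 hy)] at w
      exact posEdgeMap_injective v η w
    · have hy' : G.pos (G.bar y) := (G.pos_bar y).2 hy
      have hz' : G.pos (G.bar z) := (G.pos_bar z).2 (mt hpos.2 hy)
      have w' := congrArg G'.bar w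
      rw [← edgeMap_bar, ← edgeMap_bar, edgeMap_of_pos v η _ hy', edgeMap_of_pos v η _ hz'] at w'
      rw [← G.bar_bar y, posEdgeMap_injective v η w', G.bar_bar]
  · intro z
    by_cases hz : G'.pos z
    · obtain ⟨y, hy, rfl⟩ := posEdgeMap_surjective v η z hz
      exact ⟨y, edgeMap_of_pos v η y hy⟩
    · obtain ⟨y, hy, h⟩ := posEdgeMap_surjective v η (G'.bar z) ((G'.pos_bar z).2 hz)
      exact ⟨G.bar y, by rw [edgeMap_bar, edgeMap_of_pos v η y hy, h, G'.bar_bar]⟩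

variable (θ : ∀ P, G.vgrp P ≃* G'.vgrp (v P))
  (hmaps : ∀ {P Q : G.V} (y : {y : G.E P Q // G.pos y}) (g : G.vgrp P) (h : G.vgrp Q),
    (∃ c, G.ιo y.1 c = g ∧ G.ι y.1 c = h) ↔
      ∃ c, G'.ιo (η P Q y).1 c = θ P g ∧ G'.ι (η P Q y).1 c = θ Q h)
include hmaps

/-- An isomorphism of diagrams carries the edge group of a positive edge to the edge group of its
image. -/
theorem exists_egrp_equiv_of_pos {P Q : G.V} (y : G.E P Q) (hy : G.pos y) :
    ∃ ε : G.egrp (G.geom y) ≃* G'.egrp (G'.geom (posEdgeMap v η y hy)), ∀ c,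
      θ Q (G.ι y c) = G'.ι (posEdgeMap v η y hy) (ε c) ∧
      θ P (G.ιo y c) = G'.ιo (posEdgeMap v η y hy) (ε c) := by
  -- The images under θ of the two values at c lie on the graph of the partial isomorphism of the
  -- image edge. They come from an element of its edge group, unique by injectivity of `ιo`; this
  -- element is ε c.
  have h1 := fun c => (hmaps ⟨y, hy⟩ _ _).1 ⟨c, rfl, rfl⟩
  choose ε hεo hε using h1
  refine ⟨MulEquiv.ofBijective (MonoidHom.mk' ε fun a b => ?_) ⟨fun a b w => ?_, fun c => ?_⟩,
    fun c => ⟨(hε c).symm, (hεo c).symm⟩⟩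
  · refine G'.ιo_injective _ ?_
    rw [map_mul]
    exact (hεo _).trans (by rw [map_mul, map_mul, ← hεo, ← hεo])
  · change ε a = ε b at w
    exact G.ιo_injective y ((θ P).injective (by rw [← hεo, ← hεo, w]))
  · obtain ⟨g, hg⟩ := (θ P).surjective (G'.ιo (posEdgeMap v η y hy) c)
    obtain ⟨h, hh⟩ := (θ Q).surjective (G'.ι (posEdgeMap v η y hy) c)
    obtain ⟨d, rfl, rfl⟩ := (hmaps ⟨y, hy⟩ g h).2 ⟨c, hg.symm, hh.symm⟩
    exact ⟨d, G'.ιo_injective _ ((hεo d).trans hg)⟩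

/-- A negative edge takes the isomorphism of its reverse, transported along equal geometric edges;
the roles of `ι` and `ιo` are exchanged. -/
theorem exists_egrp_equiv {P Q : G.V} (y : G.E P Q) :
    ∃ ε : G.egrp (G.geom y) ≃* G'.egrp (G'.geom (edgeMap v η y)), ∀ c,
      θ Q (G.ι y c) = G'.ι (edgeMap v η y) (ε c) ∧
      θ P (G.ιo y c) = G'.ιo (edgeMap v η y) (ε c) := by
  by_cases hy : G.pos y
  · rw [edgeMap_of_pos v η y hy]
    exact exists_egrp_equiv_of_pos v η θ hmaps y hy
  · obtain ⟨ε, hε⟩ := exists_egrp_equiv_of_pos v η θ hmaps (G.bar y) ((G.pos_bar y).2 hy)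
    rw [edgeMap, dif_neg hy]
    refine ⟨((G.ecast (G.geom_bar y)).trans ε).trans (G'.ecast (G'.geom_bar _)), fun c => ?_⟩
    have h := hε (G.ecast (G.geom_bar y) c)
    rw [G.ι_bar_ecast, G.ιo_bar_ecast] at h
    refine ⟨h.2.trans ?_, h.1.trans ?_⟩
    · exact (G'.ι_bar_ecast _ _).symm
    · exact (G'.ιo_bar_ecast _ _).symm

theorem nonempty_iso_of_maps_iff : Nonempty (G.Iso G') := by
  choose ε hε using @exists_egrp_equiv G G' v η θ hmaps
  exact ⟨{
    vert := v
    edge := fun {P Q} => Equiv.ofBijective _ (edgeMap_bijective v η P Q)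
    edge_bar := edgeMap_bar v η
    edge_pos := pos_edgeMap v η
    vgrp := θ
    egrp := ε
    map_ι := fun y c => (hε y c).1
    map_ιo := fun y c => (hε y c).2 }⟩

end OfDiagramIso

theorem nonempty_iso_of_diagram_iso {G G' : OrientedGraphOfGroups.{u}}
    (i : G.diagram.Iso G'.diagram) : Nonempty (G.Iso G') :=
  nonempty_iso_of_maps_iff i.vert (fun P Q => i.edge (e := P) (f := Q)) i.grp
    fun {P Q} y g h => (G.maps_diagram_iff y g h).symm.trans
      ((i.maps_iff (e := P) (f := Q) y g h).trans (G'.maps_diagram_iff _ _ _))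

end OrientedGraphOfGroups

/-! ### The oriented graph of groups of a Serre diagram -/

namespace PartialIsoDiagram

variable (D : PartialIsoDiagram.{u})

/-- The graph with the edges of the directed graph of `D` and their reverses. -/
def doubleGraph : SerreGraph.{u} where
  V := D.V
  E P Q := D.Edge P Q ⊕ D.Edge Q P
  bar := Sum.swap
  bar_bar := Sum.swap_swap
  bar_ne := by rintro P (y | y) <;> simp [Sum.swap]

/-- The edge of `D` that underlies a geometric edge. -/
def baseEdge : D.doubleGraph.GeomEdge → Σ P Q : D.V, D.Edge P Q :=
  Quot.lift (fun y => match y with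
    | ⟨P, Q, .inl x⟩ => ⟨P, Q, x⟩
    | ⟨P, Q, .inr x⟩ => ⟨Q, P, x⟩) (by
      rintro ⟨P, Q, x | x⟩ _ rfl <;> rfl)

variable {D}

/-- The monomorphisms of the graph of groups of a Serre diagram. -/
def doubleι {P Q : D.V} : ∀ y : D.Edge P Q ⊕ D.Edge Q P,
    D.dom (D.baseEdge (D.doubleGraph.geom (P := P) (Q := Q) y)).2.2 →* D.grp Q
  | .inl x => (D.cod x).subtype.comp (D.φ x).toMonoidHom
  | .inr x => (D.dom x).subtype

theorem doubleι_injective {P Q : D.V} (y : D.Edge P Q ⊕ D.Edge Q P) :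
    Function.Injective (doubleι y) :=
  match y with
  | .inl x => Subtype.val_injective.comp (D.φ x).injective
  | .inr _ => Subtype.val_injective

/-- The edges of `D`, as opposed to their reverses. -/
def IsForward {P Q : D.V} (y : D.Edge P Q ⊕ D.Edge Q P) : Prop := y.isLeft = true

theorem isForward_swap {P Q : D.V} (y : D.Edge P Q ⊕ D.Edge Q P) :
    IsForward y.swap ↔ ¬ IsForward y := by
  rcases y with y | y <;> simp [IsForward]

/-- The graph of groups of a Serre diagram. The group of an edge is the domain of the partial
isomorphism. -/
def graphOfGroups (hD : D.IsSerre) : GraphOfGroups.{u} where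
  toSerreGraph := D.doubleGraph
  finite_vertices := hD.finite_vertices
  finite_edges P Q := by
    have := hD.finite_edges P Q
    have := hD.finite_edges Q P
    exact inferInstanceAs (Finite (D.Edge P Q ⊕ D.Edge Q P))
  nonempty_vertices := hD.nonempty_vertices
  connected := by
    have hsymm : ∀ P Q : D.V, Relation.ReflTransGen
        (fun a b => Nonempty (D.Edge a b ⊕ D.Edge b a)) P Q →
        Relation.ReflTransGen (fun a b => Nonempty (D.Edge a b ⊕ D.Edge b a)) Q P := by
      intro P Q h
      induction h with
      | refl => exact .refl
      | tail _ h ih => exact .head (h.map Sum.swap) ih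
    intro (P : D.V) (Q : D.V)
    change Relation.ReflTransGen (fun a b => Nonempty (D.Edge a b ⊕ D.Edge b a)) P Q
    induction hD.connected P Q with
    | rel _ _ h => exact .single (h.map Sum.inl)
    | refl _ => exact .refl
    | symm _ _ _ ih => exact hsymm _ _ ih
    | trans _ _ _ _ _ h1 h2 => exact h1.trans h2
  vgrp := D.grp
  vgroup := D.group
  egrp q := D.dom (D.baseEdge q).2.2
  egroup _ := inferInstance
  ι y := doubleι y
  ι_injective y := doubleι_injective y

/-- The oriented graph of groups of a Serre diagram. -/
def orientedGraphOfGroups (hD : D.IsSerre) : OrientedGraphOfGroups.{u} where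
  toGraphOfGroups := graphOfGroups hD
  pos y := IsForward (D := D) y
  pos_bar y := isForward_swap (D := D) y

/-- An edge and its reverse have the same base edge by definition, so the transport in `ιo` does
nothing and only the inclusion of the domain remains. -/
theorem ιo_inl (hD : D.IsSerre) {P Q : D.V} (x : D.Edge P Q) (c : D.dom x) :
    (orientedGraphOfGroups hD).ιo (P := P) (Q := Q) (Sum.inl x) c = c.1 :=
  congrArg (Subtype.val : D.dom x → D.grp P)
    (eq_of_heq ((orientedGraphOfGroups hD).ecast_heq
      ((graphOfGroups hD).geom_bar (P := P) (Q := Q) (Sum.inl x)) c))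

/-- The forward edges are the edges of `D`. -/
def forwardEquiv (P Q : D.V) : {y : D.Edge P Q ⊕ D.Edge Q P // IsForward y} ≃ D.Edge P Q where
  toFun y := y.1.getLeft y.2
  invFun x := ⟨.inl x, rfl⟩
  left_inv _ := Subtype.ext (Sum.inl_getLeft _ _)
  right_inv _ := rfl

/-- A Serre diagram is the diagram of its oriented graph of groups. -/
def orientedGraphOfGroupsIso (hD : D.IsSerre) :
    (orientedGraphOfGroups hD).diagram.Iso D where
  vert := Equiv.refl _
  edge {P Q} := forwardEquiv (D := D) P Q
  grp := fun P : D.V => MulEquiv.refl (D.grp P)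
  maps_iff := by
    intro (P : D.V) (Q : D.V) (y : {y : D.Edge P Q ⊕ D.Edge Q P // IsForward y}) (g : D.grp P)
      (h : D.grp Q)
    obtain ⟨x, rfl⟩ := (forwardEquiv P Q).symm.surjective y
    refine ((orientedGraphOfGroups hD).maps_diagram_iff (P := P) (Q := Q)
      ((forwardEquiv P Q).symm x) g h).trans ?_
    change _ ↔ D.Maps x g h
    constructor
    · rintro ⟨c, h1, h2⟩
      change D.dom x at c
      obtain rfl : c.1 = g := (ιo_inl hD x c).symm.trans h1
      exact ⟨c.2, h2⟩
    · rintro ⟨hg, rfl⟩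
      exact ⟨(⟨g, hg⟩ : D.dom x), ιo_inl hD x ⟨g, hg⟩, rfl⟩

end PartialIsoDiagram

/-! ### The fundamental groupoid and its universal property -/

theorem catIsomorphic_of_inverse {C D : Type u} [SmallCategory C] [SmallCategory D] (F : C ⥤ D)
    (H : D ⥤ C) (h1 : F ⋙ H = 𝟭 C) (h2 : H ⋙ F = 𝟭 D) : CatIsomorphic C D := by
  have : F.IsEquivalence := .mk' H (eqToIso h1.symm) (eqToIso h2)
  exact ⟨F, ⟨Function.LeftInverse.injective (g := H.obj) (Functor.congr_obj h1),
    Function.RightInverse.surjective (g := H.obj) (Functor.congr_obj h2)⟩,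
    fun _ _ => ⟨F.map_injective, F.map_surjective⟩⟩

theorem Prefunctor.eq_of_heq {V W : Type*} [Quiver V] [Quiver W] {F G : V ⥤q W}
    (hobj : ∀ X, F.obj X = G.obj X) (hmap : ∀ {X Y : V} (f : X ⟶ Y), HEq (F.map f) (G.map f)) :
    F = G := by
  obtain ⟨Fobj, Fmap⟩ := F
  obtain ⟨Gobj, Gmap⟩ := G
  obtain rfl : Fobj = Gobj := funext hobj
  congr
  funext X Y f
  exact _root_.eq_of_heq (hmap f)

theorem Quiver.FreeGroupoid.lift_map_of {V : Type*} [Quiver V] {K : Type*} [Groupoid K]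
    (φ : V ⥤q K) {X Y : V} (f : X ⟶ Y) :
    (Quiver.FreeGroupoid.lift φ).map ((Quiver.FreeGroupoid.of V).map f) = φ.map f :=
  Prefunctor.congr_hom (Quiver.FreeGroupoid.lift_spec φ) f

theorem functor_map_groupoidInv {K L : Type*} [Groupoid K] [Groupoid L] (F : K ⥤ L) {X Y : K}
    (a : X ⟶ Y) : F.map (Groupoid.inv a) = Groupoid.inv (F.map a) := by
  rw [Groupoid.inv_eq_inv, Groupoid.inv_eq_inv, Functor.map_inv]

namespace OrientedGraphOfGroups

variable (G : OrientedGraphOfGroups.{u})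

/-- A vertex, as an object of the fundamental groupoid. -/
def fundObj (P : G.V) : G.FundGroupoid := ⟨⟨P⟩⟩

/-- An element of a vertex group, as an arrow of the fundamental groupoid. -/
def fundLoop {P : G.V} (g : G.vgrp P) : G.fundObj P ⟶ G.fundObj P :=
  (Quotient.functor G.FundRel).map (G.freeLoop g)

/-- An edge, as an arrow of the fundamental groupoid. -/
def fundEdge {P Q : G.V} (y : G.E P Q) : G.fundObj P ⟶ G.fundObj Q :=
  (Quotient.functor G.FundRel).map (G.freeEdge y)

theorem fundLoop_one (P : G.V) : G.fundLoop (1 : G.vgrp P) = 𝟙 _ :=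
  CategoryTheory.Quotient.sound _ (.one P)

theorem fundLoop_mul {P : G.V} (g h : G.vgrp P) :
    G.fundLoop g ≫ G.fundLoop h = G.fundLoop (g * h) :=
  CategoryTheory.Quotient.sound _ (.mul g h)

theorem fundEdge_bar {P Q : G.V} (y : G.E P Q) :
    G.fundEdge (G.bar y) = Groupoid.inv (G.fundEdge y) :=
  CategoryTheory.Quotient.sound _ (.bar y)

theorem fundLoop_comm {P Q : G.V} (y : G.E P Q) (c : G.egrp (G.geom y)) :
    G.fundLoop (G.ιo y c) ≫ G.fundEdge y = G.fundEdge y ≫ G.fundLoop (G.ι y c) :=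
  CategoryTheory.Quotient.sound _ (.comm y c)

variable {G}

section Lift

variable {K : Type u} [Groupoid.{u} K] (o : G.V → K)
  (l : ∀ P, G.vgrp P → (o P ⟶ o P)) (x : ∀ {P Q : G.V}, G.E P Q → (o P ⟶ o Q))

/-- The functor on the free groupoid with given values on the generators. -/
def freeLift : Quiver.FreeGroupoid G.GenVert ⥤ K :=
  Quiver.FreeGroupoid.lift (V := G.GenVert)
    { obj := o
      map := fun {P Q} (y : GraphOfGroups.Gen G.toGraphOfGroups P Q) => match P, Q, y with
        | _, _, .loop g => l _ g
        | _, _, .edge y => x y }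

theorem freeLift_loop {P : G.V} (g : G.vgrp P) :
    (freeLift o l x).map (G.freeLoop g) = l P g :=
  Quiver.FreeGroupoid.lift_map_of (V := G.GenVert) _ (X := P) (Y := P) (GraphOfGroups.Gen.loop g)

theorem freeLift_edge {P Q : G.V} (y : G.E P Q) :
    (freeLift o l x).map (G.freeEdge y) = x y :=
  Quiver.FreeGroupoid.lift_map_of (V := G.GenVert) _ (X := P) (Y := Q) (GraphOfGroups.Gen.edge y)

variable (one : ∀ P, l P 1 = 𝟙 (o P))
  (mul : ∀ P (g h : G.vgrp P), l P g ≫ l P h = l P (g * h))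
  (bar : ∀ {P Q : G.V} (y : G.E P Q), x (G.bar y) = Groupoid.inv (x y))
  (comm : ∀ {P Q : G.V} (y : G.E P Q) c, l P (G.ιo y c) ≫ x y = x y ≫ l Q (G.ι y c))

/-- The functor on the fundamental groupoid with given values on the generators. -/
def fundLift : G.FundGroupoid ⥤ K :=
  CategoryTheory.Quotient.lift _ (freeLift o l x) (by
    rintro _ _ _ _ (P | ⟨g, h⟩ | ⟨y⟩ | ⟨y, c⟩)
    · exact (freeLift_loop o l x _).trans (one P)
    · rw [Functor.map_comp]
      have h1 := freeLift_loop o l x g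
      have h2 := freeLift_loop o l x h
      have h3 := freeLift_loop o l x (g * h)
      rw [h1, h2, h3]
      exact mul _ g h
    · have h1 := freeLift_edge o l x y
      have h2 := freeLift_edge o l x (G.bar y)
      refine h2.trans ((bar y).trans ?_)
      simp only [Groupoid.inv_eq_inv]
      rw [Functor.map_inv]
      simp only [h1]
      rfl
    · rw [Functor.map_comp, Functor.map_comp]
      have h1 := freeLift_loop o l x (G.ιo y c)
      have h2 := freeLift_loop o l x (G.ι y c)
      have h3 := freeLift_edge o l x y
      rw [h1, h2, h3]
      exact comm y c)

theorem fundLift_loop {P : G.V} (g : G.vgrp P) :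
    (fundLift (G := G) o l x one mul bar comm).map (G.fundLoop g) = l P g :=
  freeLift_loop o l x g

theorem fundLift_edge {P Q : G.V} (y : G.E P Q) :
    (fundLift (G := G) o l x one mul bar comm).map (G.fundEdge y) = x y :=
  freeLift_edge o l x y

end Lift

/-- A functor on the fundamental groupoid is determined by its values on loops and edges, by the
uniqueness clauses for quotients and free groupoids. -/
theorem functor_eq_id {F : G.FundGroupoid ⥤ G.FundGroupoid}
    (hobj : ∀ P, F.obj (G.fundObj P) = G.fundObj P)
    (hloop : ∀ {P : G.V} (g : G.vgrp P), HEq (F.map (G.fundLoop g)) (G.fundLoop g))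
    (hedge : ∀ {P Q : G.V} (y : G.E P Q), HEq (F.map (G.fundEdge y)) (G.fundEdge y)) :
    F = 𝟭 _ := by
  apply CategoryTheory.Quotient.lift_unique'
  refine (Quiver.FreeGroupoid.lift_unique _ _ rfl).trans
    (Quiver.FreeGroupoid.lift_unique _ (Quotient.functor G.FundRel ⋙ 𝟭 _) ?_).symm
  refine (Prefunctor.eq_of_heq (V := G.GenVert) (fun P => hobj P) ?_).symm
  intro (P : G.V) (Q : G.V) (y : GraphOfGroups.Gen G.toGraphOfGroups P Q)
  cases y with
  | loop g => exact hloop g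
  | edge y => exact hedge y

/-! ### Comparison with the universal groupoid of `⟨D(G)⟩` -/

section Universal

variable (G)

/-- A vertex, as an object of the universal groupoid. -/
noncomputable def univObj (P : G.V) : FreeGroupoid G.diagram.PresCat :=
  FreeGroupoid.mk (G.diagram.obj P)

/-- An element of a vertex group, as an arrow of the universal groupoid. -/
noncomputable def univLoop (P : G.V) (g : G.vgrp P) : G.univObj P ⟶ G.univObj P :=
  FreeGroupoid.homMk (G.diagram.loop (e := P) g)

/-- A positive edge, as an arrow of the universal groupoid. -/
noncomputable def univPosEdge {P Q : G.V} (y : G.E P Q) (hy : G.pos y) :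
    G.univObj P ⟶ G.univObj Q :=
  FreeGroupoid.homMk (G.diagram.edge (e := P) (f := Q) ⟨y, hy⟩)

open Classical in
/-- An edge, as an arrow of the universal groupoid. -/
noncomputable def univEdge {P Q : G.V} (y : G.E P Q) : G.univObj P ⟶ G.univObj Q :=
  if hy : G.pos y then G.univPosEdge y hy
  else Groupoid.inv (G.univPosEdge (G.bar y) ((G.pos_bar y).2 hy))

theorem univEdge_of_pos {P Q : G.V} (y : G.E P Q) (hy : G.pos y) :
    G.univEdge y = G.univPosEdge y hy := dif_pos hy

theorem univEdge_bar {P Q : G.V} (y : G.E P Q) :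
    G.univEdge (G.bar y) = Groupoid.inv (G.univEdge y) := by
  by_cases hy : G.pos y
  · have h : ¬ G.pos (G.bar y) := fun h => (G.pos_bar y).1 h hy
    rw [univEdge, dif_neg h, univEdge_of_pos G y hy]
    simp only [G.bar_bar]
  · have h : G.pos (G.bar y) := (G.pos_bar y).2 hy
    rw [univEdge_of_pos G _ h, univEdge, dif_neg hy, Groupoid.inv_eq_inv, Groupoid.inv_eq_inv,
      IsIso.inv_inv]

theorem univLoop_one (P : G.V) : G.univLoop P 1 = 𝟙 _ :=
  (congrArg (FreeGroupoid.of G.diagram.PresCat).map (G.diagram.loop_one P)).trans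
    (CategoryTheory.Functor.map_id _ _)

theorem univLoop_mul (P : G.V) (g h : G.vgrp P) :
    G.univLoop P g ≫ G.univLoop P h = G.univLoop P (g * h) :=
  ((congrArg (FreeGroupoid.of G.diagram.PresCat).map
    (G.diagram.loop_mul (e := P) g h)).trans (Functor.map_comp _ _ _)).symm

/-- For a positive edge this is the image of a relation of `⟨D(G)⟩`; for a negative edge, the
relation of its reverse is solved for the inverse. -/
theorem univLoop_comm {P Q : G.V} (y : G.E P Q) (c : G.egrp (G.geom y)) :
    G.univLoop P (G.ιo y c) ≫ G.univEdge y = G.univEdge y ≫ G.univLoop Q (G.ι y c) := by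
  have key : ∀ {P Q : G.V} (y : G.E P Q) (c : G.egrp (G.geom y)), G.pos y →
      G.univLoop P (G.ιo y c) ≫ G.univEdge y = G.univEdge y ≫ G.univLoop Q (G.ι y c) := by
    intro P Q y c hy
    rw [G.univEdge_of_pos y hy]
    have := (G.diagram.maps_iff (e := P) (f := Q) ⟨y, hy⟩ _ _).1
      ((G.maps_diagram_iff ⟨y, hy⟩ _ _).2 ⟨c, rfl, rfl⟩)
    exact ((Functor.map_comp _ _ _).symm.trans
      (congrArg (FreeGroupoid.of G.diagram.PresCat).map this)).trans (Functor.map_comp _ _ _)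
  by_cases hy : G.pos y
  · exact key y c hy
  · have h := key (G.bar y) (G.ecast (G.geom_bar y) c) ((G.pos_bar y).2 hy)
    rw [G.ιo_bar_ecast, G.ι_bar_ecast, univEdge_bar, Groupoid.inv_eq_inv] at h
    rw [← IsIso.inv_comp_eq, ← Category.assoc, ← h, Category.assoc, IsIso.inv_hom_id,
      Category.comp_id]

/-- The functor from the fundamental groupoid to the universal groupoid. -/
noncomputable def toUniversal : G.FundGroupoid ⥤ FreeGroupoid G.diagram.PresCat :=
  fundLift (G := G) G.univObj G.univLoop G.univEdge G.univLoop_one G.univLoop_mul G.univEdge_bar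
    G.univLoop_comm

theorem toUniversal_loop {P : G.V} (g : G.vgrp P) :
    G.toUniversal.map (G.fundLoop g) = G.univLoop P g :=
  fundLift_loop (G := G) G.univObj G.univLoop G.univEdge G.univLoop_one G.univLoop_mul
    G.univEdge_bar G.univLoop_comm g

theorem toUniversal_edge {P Q : G.V} (y : G.E P Q) :
    G.toUniversal.map (G.fundEdge y) = G.univEdge y :=
  fundLift_edge (G := G) G.univObj G.univLoop G.univEdge G.univLoop_one G.univLoop_mul
    G.univEdge_bar G.univLoop_comm y

theorem fundLoop_maps {P Q : G.V} (y : {y : G.E P Q // G.pos y})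
    (g : G.diagram.dom (e := P) (f := Q) y) :
    G.fundLoop g.1 ≫ G.fundEdge y.1 =
      G.fundEdge y.1 ≫ G.fundLoop (G.diagram.φ (e := P) (f := Q) y g).1 := by
  obtain ⟨c, h1, h2⟩ := (G.maps_diagram_iff y _ _).1 ⟨g.2, rfl⟩
  have := G.fundLoop_comm y.1 c
  rw [h1, h2] at this
  exact this

/-- The functor from the category of the diagram of `G` to the fundamental groupoid. -/
noncomputable def presToFund : G.diagram.PresCat ⥤ G.FundGroupoid :=
  PartialIsoDiagram.lift (D := G.diagram) G.fundObj (fun _ g => G.fundLoop g)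
    (fun y => G.fundEdge y.1) G.fundLoop_one (fun _ g h => G.fundLoop_mul g h) G.fundLoop_maps

theorem presToFund_loop {P : G.V} (g : G.vgrp P) :
    G.presToFund.map (G.diagram.loop (e := P) g) = G.fundLoop g :=
  PartialIsoDiagram.lift_loop (D := G.diagram) G.fundObj (fun _ g => G.fundLoop g)
    (fun y => G.fundEdge y.1) G.fundLoop_one (fun _ g h => G.fundLoop_mul g h) G.fundLoop_maps g

theorem presToFund_edge {P Q : G.V} (y : {y : G.E P Q // G.pos y}) :
    G.presToFund.map (G.diagram.edge (e := P) (f := Q) y) = G.fundEdge y.1 :=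
  PartialIsoDiagram.lift_edge (D := G.diagram) G.fundObj (fun _ g => G.fundLoop g)
    (fun y => G.fundEdge y.1) G.fundLoop_one (fun _ g h => G.fundLoop_mul g h) G.fundLoop_maps y

/-- The functor from the universal groupoid to the fundamental groupoid. -/
noncomputable def fromUniversal : FreeGroupoid G.diagram.PresCat ⥤ G.FundGroupoid :=
  FreeGroupoid.lift G.presToFund

theorem fromUniversal_loop {P : G.V} (g : G.vgrp P) :
    G.fromUniversal.map (G.univLoop P g) = G.fundLoop g :=
  (FreeGroupoid.lift_map_homMk _ _).trans (G.presToFund_loop g)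

theorem fromUniversal_posEdge {P Q : G.V} (y : G.E P Q) (hy : G.pos y) :
    G.fromUniversal.map (G.univPosEdge y hy) = G.fundEdge y :=
  (FreeGroupoid.lift_map_homMk _ _).trans (G.presToFund_edge ⟨y, hy⟩)

theorem fromUniversal_edge {P Q : G.V} (y : G.E P Q) :
    G.fromUniversal.map (G.univEdge y) = G.fundEdge y := by
  by_cases hy : G.pos y
  · rw [G.univEdge_of_pos y hy, fromUniversal_posEdge]
  · obtain ⟨z, rfl⟩ : ∃ z, y = G.bar z := ⟨G.bar y, (G.bar_bar y).symm⟩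
    rw [G.pos_bar, not_not] at hy
    have h := G.fromUniversal_posEdge z hy
    rw [← univEdge_of_pos] at h
    rw [univEdge_bar, fundEdge_bar]
    exact (functor_map_groupoidInv G.fromUniversal _).trans (congrArg Groupoid.inv h)

theorem toUniversal_fromUniversal : G.toUniversal ⋙ G.fromUniversal = 𝟭 _ :=
  functor_eq_id (fun _ => rfl)
    (fun g => heq_of_eq
      ((congrArg G.fromUniversal.map (G.toUniversal_loop g)).trans (G.fromUniversal_loop g)))
    (fun y => heq_of_eq
      ((congrArg G.fromUniversal.map (G.toUniversal_edge y)).trans (G.fromUniversal_edge y)))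

/-- Arrows of `⟨D(G)⟩` are products of loops and positive edges, so only these need to be followed.
-/
theorem presToFund_toUniversal {P Q : G.diagram.V} (a : G.diagram.obj P ⟶ G.diagram.obj Q) :
    G.toUniversal.map (G.presToFund.map a) = (FreeGroupoid.of G.diagram.PresCat).map a := by
  induction a using PartialIsoDiagram.hom_induction with
  | loop g => exact (congrArg G.toUniversal.map (G.presToFund_loop g)).trans (G.toUniversal_loop g)
  | step g y a ih =>
    have h1 := (congrArg G.toUniversal.map (G.presToFund_loop g)).trans (G.toUniversal_loop g)
    have h2 := ((congrArg G.toUniversal.map (G.presToFund_edge y)).trans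
      (G.toUniversal_edge y.1)).trans (G.univEdge_of_pos y.1 y.2)
    simp only [Functor.map_comp]
    rw [ih]
    exact congrArg₂ (fun p q => p ≫ q ≫ _) h1 h2

theorem fromUniversal_toUniversal : G.fromUniversal ⋙ G.toUniversal = 𝟭 _ := by
  refine (FreeGroupoid.lift_unique _ _ ?_).trans
    (FreeGroupoid.lift_unique (FreeGroupoid.of _) (𝟭 _) rfl).symm
  refine Functor.hext (fun _ => rfl) fun X Y a => heq_of_eq ?_
  refine (congrArg G.toUniversal.map (FreeGroupoid.lift_map_homMk _ _)).trans ?_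
  exact G.presToFund_toUniversal (P := PartialIsoDiagram.vertex X)
    (Q := PartialIsoDiagram.vertex Y) a

theorem catIsomorphic_fundGroupoid :
    CatIsomorphic G.FundGroupoid (FreeGroupoid G.diagram.PresCat) :=
  catIsomorphic_of_inverse _ _ G.toUniversal_fromUniversal G.fromUniversal_toUniversal

end Universal

end OrientedGraphOfGroups

/-- The universal functor is surjective on objects and preserves zig-zags. -/
theorem zigzagConnected_freeGroupoid {C : Type u} [SmallCategory C] (hC : IsSerreCategory C) :
    ZigzagConnected (FreeGroupoid C) := by
  intro X Y
  obtain ⟨e, rfl⟩ := FreeGroupoid.of_obj_bijective.2 X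
  obtain ⟨f, rfl⟩ := FreeGroupoid.of_obj_bijective.2 Y
  exact zigzag_obj_of_zigzag (FreeGroupoid.of C) (hC.connected e f)

theorem mainTheorem2 :
    -- (1) oriented graphs of groups correspond to Serre diagrams of partial isomorphisms
    ((∀ G : OrientedGraphOfGroups.{u}, G.diagram.IsSerre) ∧
      (∀ D : PartialIsoDiagram.{u}, D.IsSerre →
        ∃ G : OrientedGraphOfGroups.{u}, Nonempty (G.diagram.Iso D)) ∧
      (∀ G G' : OrientedGraphOfGroups.{u},
        Nonempty (G.Iso G') ↔ Nonempty (G.diagram.Iso G'.diagram))) ∧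
    -- (2) Serre diagrams of partial isomorphisms correspond to Serre categories
    ((∀ D : PartialIsoDiagram.{u}, D.IsSerre →
        IsSerreCategory D.PresCat ∧
        ∃ (hD : IsReesCategory D.PresCat) (T : AtomicTransversal D.PresCat),
          Nonempty ((T.diagram hD).Iso D)) ∧
      (∀ (C : Type u) [SmallCategory C] (hC : IsSerreCategory C),
        Nonempty (AtomicTransversal C) ∧
        ∀ T : AtomicTransversal C,
          (T.diagram hC.toIsReesCategory).IsSerre ∧
          CatIsomorphic (T.diagram hC.toIsReesCategory).PresCat C) ∧
      (∀ D D' : PartialIsoDiagram.{u}, D.IsSerre → D'.IsSerre →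
        (CatIsomorphic D.PresCat D'.PresCat ↔ Nonempty (D.ConjIso D')))) ∧
    -- (3) the fundamental groupoid is the universal groupoid of the associated Serre category
    (∀ G : OrientedGraphOfGroups.{u},
      CatIsomorphic G.FundGroupoid (FreeGroupoid G.diagram.PresCat)) ∧
    -- (4) the universal groupoid of a Serre category is connected
    (∀ (C : Type u) [SmallCategory C], IsSerreCategory C →
      ZigzagConnected (FreeGroupoid C)) := by
  refine ⟨⟨OrientedGraphOfGroups.isSerre_diagram, fun D hD =>
      ⟨_, ⟨PartialIsoDiagram.orientedGraphOfGroupsIso hD⟩⟩, fun G G' =>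
      ⟨fun ⟨i⟩ => ⟨i.diagram⟩, fun ⟨i⟩ => OrientedGraphOfGroups.nonempty_iso_of_diagram_iso i⟩⟩,
    ⟨fun D hD => ⟨hD.isSerreCategory, D.isReesCategory_presCat, D.edgeTransversal,
      ⟨D.edgeTransversalIso _⟩⟩, fun C _ hC => ⟨nonempty_atomicTransversal C, fun T =>
      ⟨T.isSerre_diagram hC, (T.isTransversal_realization hC.toIsReesCategory).catIsomorphic
        hC.toIsReesCategory hC.skeletal⟩⟩, fun D D' _ _ =>
      ⟨PartialIsoDiagram.nonempty_conjIso_of_catIsomorphic, fun ⟨i⟩ => i.catIsomorphic⟩⟩,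
    fun G => G.catIsomorphic_fundGroupoid, fun C _ hC => zigzagConnected_freeGroupoid hC⟩
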